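/- **Data model.** Let $d$ be an even integer, $r=\lfloor d/\sqrt{\ln d}\rfloor$, $n=d^6$, $\varepsilon_1=0.3$, $\varepsilon_2=0.5$, and let $[d]=S_1\sqcup S_2$ with $|S_1|=|S_2|=d/2$. The dataset $P\subset\{0,1\}^d$ consists of the point $p_a=0^d$; of $\lfloor\sqrt d\rfloor$ planted points, i.i.d. uniform among the points at Hamming distance exactly $r+1$ from $p_a$ that differ from $p_a$ only on $S_1$; and of $n-1-\lfloor\sqrt d\rfloor$ i.i.d. background points with independent coordinates, the $i$-th being Bernoulli$(\varepsilon_j)$ for $i\in S_j$. The planted and background points are independent of each other. A *near pair* is a pair $(q,p)$ with $p\in P$, $q\in\{0,1\}^d$ and $\|q-p\|_1\le r$. Let $c=1+\frac1r$, so $cr=r+1$. **Optimized trees.** Fix an integer $m>1$ and $\rho\in(0.1,1)$. The root has bucket $P$. A node $v$ with bucket $P^v$ and set $A$ of coordinates not used above it is a leaf if $|P^v|\le 1$. Otherwise a coordinate $i$ is drawn from a distribution $\pi_v$ on $A$, the bucket is split by the bit at $i$, and the two parts are treated recursively and independently, without coordinate $i$. Here $\pi_v$ is, up to an additive error $\varepsilon\ge0$,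 a maximizer over distributions $\pi$ on $A$ of $$\min_{p\in P^v,\ \|q-p\|_1\le r}\ \sum_{i}\pi_i\, n_{i,p_i}^{-\rho_v}\,\mathbb 1\{p_i=q_i\},\qquad n_{i,b}=|\{x\in P^v: x_i=b\}|,$$ with exponent $\rho_v=\rho$ if $|P^v|>d$ and $\rho_v=0$ if $|P^v|\le d$. A query $q$ descends from the root; at every internal node it draws $m$ independent uniform points of the bucket and halts if one of them is within distance $cr$ of $q$, otherwise it moves to the child given by its bit; at a leaf it halts. The success probability of a near pair $(q,p)$ is the probability, over the tree and the samples, that $p$ lies in the bucket at which $q$ halts. Let $\mathrm{OPT}$ be the minimum of it over all near pairs. **Uniform LSH.** With $k$ hash functions, uniform LSH samples $k$ i.i.d. uniform coordinates, and succeeds on $(q,p)$ if $q$ and $p$ agree on all of them. Let $U_k$ be its minimum success probability over all near pairs. Let $\rho_u=\frac{\ln(1-r/d)}{\ln(1-(r+1)/d)}$. For approximation factor $c$, the nominal (real) number of hash functions on $N$ points is $k(N)=\ln N/\ln\frac1{1-(r+1)/d}$, for which $(1-\frac rd)^{k(N)}=N^{-\rho_u}$; so the nominal success probability on $P$ at distance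 $r$ is $n^{-\rho_u}$. Let $$k_u=\frac{\ln(n/d)}{\ln(1/\varepsilon_1)},\qquad \bar\varepsilon=\frac{\ln(1-\frac rd)}{\ln\!\big(1-(1-\frac1m)\frac{r+1}d\big)}-\rho_u,\qquad F=d^{-\bar\varepsilon}\Big(1-\frac1{\sqrt{\ln d}}\Big)^{-k_u}.$$ **Theorem.** There are universal constants $a,b>0$ such that for every integer $m>1$ and every $\rho\in(0.1,1)$, for all sufficiently large $d$ (depending on $m,\rho$), $$F\ \ge\ a\,d^{-\bar\varepsilon}\exp\!\big(b\sqrt{\ln d}\big),$$ and there is $\varepsilon_0=\varepsilon_0(d,m,\rho)>0$ such that, if $d$ is even, for every such partition $S_1\sqcup S_2$, with probability at least $0.99$ over the data: $|P|=n$, and for every $\varepsilon\in[0,\varepsilon_0]$ and every choice of the distributions $\pi_v$ as above (in particular for exact maximizers), $$\mathrm{OPT}\ \ge\ F\cdot n^{-\rho_u}\qquad\text{and}\qquad \mathrm{OPT}\ \ge\ F\cdot U_k\quad\text{for every integer } k\ge\big\lfloor k_u+k(d)\big\rfloor .$$ The second bound covers uniform LSH with $k_u$ hash functions to pass from $n$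 to $d$ points followed by $k(d)$ hash functions for the remaining $d$ points, even with the total rounded down. -/

import Mathlib

open MeasureTheory ProbabilityTheory Filter
open scoped ENNReal

noncomputable section

namespace LSH

/-- The Hamming cube `{0,1}^d`; `true` is the bit 1 and `false` the bit 0. -/
abbrev Cube (d : ℕ) := Fin d → Bool

/-- The part of the bucket `B` whose points have the bit `b` at the coordinate `i`. -/
def side {d : ℕ} (B : Finset (Cube d)) (i : Fin d) (b : Bool) : Finset (Cube d) :=
  B.filter fun x => x i = b

/-! ### The min-max optimization at a node -/

/-- The payoff `∑ i, π i * n_{i, p i} ^ (-ρ) * 1{p i = q i}` of the distribution `π` over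
coordinates against the query / near neighbor pair `(q, p)`, at a node with bucket `B`. -/
def payoff {d : ℕ} (ρ : ℝ) (B : Finset (Cube d)) (π : PMF (Fin d)) (q p : Cube d) : ℝ :=
  ∑ i, (π i).toReal * (if p i = q i then ((side B i (p i)).card : ℝ) ^ (-ρ) else 0)

/-- The worst payoff of `π` over all pairs `(q, p)` with `p` in the bucket `B` and `q` within
Hamming distance `r` of `p` (a minimum over a finite set). -/
def worstPayoff {d : ℕ} (r : ℕ) (ρ : ℝ) (B : Finset (Cube d)) (π : PMF (Fin d)) : ℝ :=
  ⨅ y : {y : Cube d × Cube d // y.2 ∈ B ∧ hammingDist y.1 y.2 ≤ r}, payoff ρ B π y.1.1 y.1.2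

/-- `π` is a distribution over the unused coordinates `A` which solves the max-min problem
`max_π min_{(q,p)} payoff` up to the additive error `ε`. -/
def IsMaxMin {d : ℕ} (r : ℕ) (ρ ε : ℝ) (B : Finset (Cube d)) (A : Finset (Fin d))
    (π : PMF (Fin d)) : Prop :=
  π.support ⊆ (A : Set (Fin d)) ∧
    ∀ π' : PMF (Fin d), π'.support ⊆ (A : Set (Fin d)) →
      worstPayoff r ρ B π' ≤ worstPayoff r ρ B π + ε

/-- The rule by which the nodes choose their distributions: it maps the bucket of a node and the
set of coordinates not yet used above that node to a distribution over coordinates. -/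
abbrev HashRule (d : ℕ) := Finset (Cube d) → Finset (Fin d) → PMF (Fin d)

/-- The exponent used at a node: `ρ` until the bucket has size `d`, and `0` after that. -/
def nodeExponent {d : ℕ} (ρ : ℝ) (B : Finset (Cube d)) : ℝ :=
  if d < B.card then ρ else 0

/-- The rule `σ` solves, up to the additive error `ε`, the max-min problem of every node that is
split (stopping condition `C`). -/
def IsOptimizedRule {d : ℕ} (r C : ℕ) (ρ ε : ℝ) (σ : HashRule d) : Prop :=
  ∀ (B : Finset (Cube d)) (A : Finset (Fin d)), C < B.card → A.Nonempty →
    IsMaxMin r (nodeExponent ρ B) ε B A (σ B A)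

/-! ### Building and querying a tree -/

/-- A hash tree. Every node stores its bucket; an internal node also stores the coordinate on which
it splits the bucket, and its two children (for the bits 0 and 1). -/
inductive HashTree (d : ℕ) where
  | leaf (B : Finset (Cube d)) : HashTree d
  | node (B : Finset (Cube d)) (i : Fin d) (l r : HashTree d) : HashTree d

/-- The random tree built over the bucket `B` with unused coordinates `A`. A bucket of size at most
`C` is a leaf; otherwise a coordinate is drawn from `σ B A`, and the two parts of the bucket are
treated recursively and independently, without that coordinate. The first argument bounds the
depth. -/
def buildTree {d : ℕ} (σ : HashRule d) (C : ℕ) :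
    ℕ → Finset (Cube d) → Finset (Fin d) → PMF (HashTree d)
  | 0, B, _ => PMF.pure (.leaf B)
  | k + 1, B, A =>
    if B.card ≤ C then PMF.pure (.leaf B)
    else
      (σ B A).bind fun i =>
        (buildTree σ C k (side B i false) (A.erase i)).bind fun l =>
          (buildTree σ C k (side B i true) (A.erase i)).bind fun r =>
            PMF.pure (.node B i l r)

/-- Draw `m` independent uniform points of the bucket `B` and report whether one of them is an
approximate near neighbor of `q`, that is, within Hamming distance `R` of `q`. -/
def sampleHit {d : ℕ} (m R : ℕ) (q : Cube d) (B : Finset (Cube d)) : PMF Bool :=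
  if h : B.Nonempty then
    (PMF.uniformOfFinset (Fintype.piFinset fun _ : Fin m => B)
      (Fintype.piFinset_nonempty.2 fun _ => h)).map
        fun s => decide (∃ j, hammingDist q (s j) ≤ R)
  else PMF.pure false

/-- Query the tree: at an internal node halt if the sampled points contain an approximate near
neighbor of `q`, otherwise move to the child chosen by `q`; at a leaf halt. The outcome is the
bucket of the node at which the query halts. -/
def queryTree {d : ℕ} (m R : ℕ) (q : Cube d) : HashTree d → PMF (Finset (Cube d))
  | .leaf B => PMF.pure B
  | .node B i l r =>
    (sampleHit m R q B).bind fun hit =>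
      if hit then PMF.pure B
      else if q i = false then queryTree m R q l else queryTree m R q r

/-- The probability, over the construction of a tree for the dataset `P` and over the query
algorithm, that the query `q` halts at a node whose bucket contains `p`. -/
def treeSuccess {d : ℕ} (σ : HashRule d) (C m R : ℕ) (P : Finset (Cube d)) (q p : Cube d) :
    ℝ≥0∞ :=
  ((buildTree σ C d P Finset.univ).bind (queryTree m R q)).toOuterMeasure {B | p ∈ B}

/-- The probability that `q` and `p` agree on `k` independent uniformly random coordinates: the
success probability of uniform LSH with `k` hash functions. -/
def uniformSuccess {d : ℕ} (k : ℕ) (q p : Cube d) : ℝ≥0∞ :=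
  (uniformOn Set.univ : Measure (Fin k → Fin d)) {h | ∀ j, q (h j) = p (h j)}

/-- The minimum of a success probability over all pairs of a point `p` of the dataset and a query
`q` within Hamming distance `r` of `p`. -/
def minSuccess {d : ℕ} (P : Finset (Cube d)) (r : ℕ) (f : Cube d → Cube d → ℝ≥0∞) : ℝ≥0∞ :=
  ⨅ (p : Cube d) (_ : p ∈ P) (q : Cube d) (_ : hammingDist q p ≤ r), f q p

/-! ### The mixture model -/

/-- The law of a point with independent coordinates, which are Bernoulli(`e₁`) on `S₁` and
Bernoulli(`e₂`) off `S₁`. -/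
def backgroundLaw {d : ℕ} (e₁ e₂ : unitInterval) (S₁ : Finset (Fin d)) : Measure (Cube d) :=
  Measure.pi fun i => bernoulliMeasure true false (if i ∈ S₁ then e₁ else e₂)

/-- The cluster center `0^d`. -/
def center (d : ℕ) : Cube d := fun _ => false

/-- The uniform law on the points at Hamming distance `t` from the center which differ from the
center only on `S₁`. -/
def plantedLaw {d : ℕ} (t : ℕ) (S₁ : Finset (Fin d)) : Measure (Cube d) :=
  uniformOn {x | hammingDist x (center d) = t ∧ ∀ i, x i = true → i ∈ S₁}

/-- The law of `N` independent background points and `s` independent planted points. -/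
def dataLaw {d : ℕ} (e₁ e₂ : unitInterval) (S₁ : Finset (Fin d)) (t N s : ℕ) :
    Measure ((Fin N → Cube d) × (Fin s → Cube d)) :=
  (Measure.pi fun _ => backgroundLaw e₁ e₂ S₁).prod (Measure.pi fun _ => plantedLaw t S₁)

/-- The dataset: the center, the background points and the planted points. -/
def dataset {d N s : ℕ} (ω : (Fin N → Cube d) × (Fin s → Cube d)) : Finset (Cube d) :=
  insert (center d) (Finset.univ.image ω.1 ∪ Finset.univ.image ω.2)

/-! ### The parameters -/

/-- `ε₁ = 0.3`. -/
def eps₁ : unitInterval := ⟨3 / 10, by norm_num, by norm_num⟩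

/-- `ε₂ = 0.5`. -/
def eps₂ : unitInterval := ⟨1 / 2, by norm_num, by norm_num⟩

/-- The radius `r = d / √(ln d)`, rounded down. -/
def radius (d : ℕ) : ℕ := ⌊(d : ℝ) / √(Real.log d)⌋₊

/-- The number `n = d ^ 6` of points of the dataset. -/
def numPoints (d : ℕ) : ℕ := d ^ 6

/-- The number `√d` of planted points other than the center, rounded down. -/
def numPlanted (d : ℕ) : ℕ := Nat.sqrt d

/-- The number of background points, for a total of `n` points (`1 + √d ≤ n` once `2 ≤ d`). -/
def numBackground (d : ℕ) : ℕ := numPoints d - (1 + numPlanted d)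

/-- `ρ_u = ln(1 - r/d) / ln(1 - c r/d)` with `c r = r + 1`. -/
def rhoUniform (d : ℕ) : ℝ :=
  Real.log (1 - radius d / d) / Real.log (1 - (radius d + 1) / d)

/-- `ln(1 - r/d) / ln(1 - (1 - 1/m) (r+1)/d)`. -/
def rhoOptimized (m d : ℕ) : ℝ :=
  Real.log (1 - radius d / d) / Real.log (1 - (1 - 1 / m) * ((radius d + 1) / d))

/-- The exponent `ε̄`. -/
def epsBar (m d : ℕ) : ℝ := rhoOptimized m d - rhoUniform d

/-- `k_u = ln(n/d) / ln(1/ε₁)`. -/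
def kU (d : ℕ) : ℝ := Real.log (numPoints d / d) / Real.log (1 / (eps₁ : ℝ))

/-- The real number of hash functions that uniform LSH with radius `r` and `c r = r + 1` uses on
`N` points: the `k` with `(1 - c r/d) ^ k = 1/N`, hence `(1 - r/d) ^ k = N ^ (-ρ_u)`. -/
def uniformHashes (N d : ℕ) : ℝ := Real.log N / Real.log (1 / (1 - (radius d + 1) / d))

/-- The improvement factor `d ^ (-ε̄) * (1 - 1/√(ln d)) ^ (-k_u)`. -/
def factor (m d : ℕ) : ℝ :=
  (d : ℝ) ^ (-epsBar m d) * (1 - 1 / √(Real.log d)) ^ (-kU d)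

end LSH

end

/-!
Write `L = ln d`. All success probabilities below are compared with `exp (-400 √L) / d`.

*Optimized trees do at least this well.* While a bucket `B` has more than `d` points, a near-optimal
distribution `π` must be spread out: averaged over `p ∈ B`, the weight `n_{i, p i} ^ (-ρ)` of a
coordinate `i` is at most `2 ^ ρ |B| ^ (-ρ)`, because `t ↦ t ^ (1 - ρ)` is concave, with equality for
an even split. The uniform distribution over the unused coordinates off `S₁`, which split the bucket
almost evenly, guarantees `2 ^ ρ |B| ^ (-ρ) (1 - O(1 / √L))` against every near pair. So a
near-optimal `π` gives mass at most `6 / √L` to every set of `r` coordinates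
(`IsMaxMin.le_mass`), in particular to those on which `q` and `p` differ. Every coordinate
shrinks the bucket by a factor `4 / 5`, so `q` and `p` stay together down to a bucket of at most `d`
points with probability at least `(1 - 6 / √L) ^ (26 L)`; there, one sampling step draws `p` itself
with probability at least `1 / d` (`IsBalanced.le_treeSuccess`).

*The data is balanced.* The share of a bit among the background points in a subcube is controlled by
an exponential moment (`measure_count_le`) and a union bound over all subcubes of codimension `O(L)`;
this covers every bucket of every tree, whatever the distributions at the nodes are. The few planted
points cannot unbalance a bucket of more than `d` points (`IsTypical.isBalanced`). A union bound also
shows that the points are distinct (`dataLaw_not_isTypical_le`).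

*The bounds to be beaten are smaller.* The query at distance `r` from the center shows that
`F * U_k ≤ d ^ (-ε̄ - ρ_u) exp (17 √L)`, and `F * n ^ (-ρ_u)` is at most this too. Here `ε̄ + ρ_u` is
`rhoOptimized m d`, which tends to `m / (m - 1) > 1` (`IsLarge.le_rhoOptimized`), so that a power
of `d` is left over to absorb all factors `exp (O(√L))`.
-/

namespace LSH

/-! ### Success probabilities of a random tree -/

/-- The probability that the query `q` halts in a bucket containing `p`, in the random tree of depth
at most `k` built over the bucket `B` with unused coordinates `A`. -/
noncomputable def bucketSuccess {d : ℕ} (σ : HashRule d) (C m R k : ℕ) (B : Finset (Cube d))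
    (A : Finset (Fin d)) (q p : Cube d) : ℝ≥0∞ :=
  ((buildTree σ C k B A).bind (queryTree m R q)).toOuterMeasure {B | p ∈ B}

theorem _root_.PMF.toOuterMeasure_apply_le_one {α : Type*} (μ : PMF α) (s : Set α) :
    μ.toOuterMeasure s ≤ 1 := by
  rw [PMF.toOuterMeasure_apply]
  exact (ENNReal.tsum_le_tsum fun a => Set.indicator_le_self _ _ a).trans_eq μ.tsum_coe

theorem bucketSuccess_zero {d : ℕ} (σ : HashRule d) (C m R : ℕ) {B : Finset (Cube d)}
    (A : Finset (Fin d)) (q : Cube d) {p : Cube d} (hp : p ∈ B) :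
    bucketSuccess σ C m R 0 B A q p = 1 := by
  simp [bucketSuccess, buildTree, queryTree, PMF.toOuterMeasure_pure_apply, hp,
    -PMF.toOuterMeasure_apply_fintype]

theorem bucketSuccess_of_card_le {d : ℕ} (σ : HashRule d) {C : ℕ} (m R k : ℕ)
    {B : Finset (Cube d)} (A : Finset (Fin d)) (q : Cube d) {p : Cube d} (hp : p ∈ B)
    (hB : B.card ≤ C) : bucketSuccess σ C m R k B A q p = 1 := by
  cases k with
  | zero => exact bucketSuccess_zero σ C m R A q hp
  | succ k => simp [bucketSuccess, buildTree, queryTree, PMF.toOuterMeasure_pure_apply, hp, hB,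
      -PMF.toOuterMeasure_apply_fintype]

theorem bucketSuccess_succ {d : ℕ} (σ : HashRule d) {C : ℕ} (m R k : ℕ)
    {B : Finset (Cube d)} (A : Finset (Fin d)) (q p : Cube d) (hB : C < B.card) :
    bucketSuccess σ C m R (k + 1) B A q p =
      ∑' i, σ B A i * ∑' l, buildTree σ C k (side B i false) (A.erase i) l *
        ∑' r, buildTree σ C k (side B i true) (A.erase i) r *
          (queryTree m R q (.node B i l r)).toOuterMeasure {B | p ∈ B} := by
  simp only [bucketSuccess, buildTree, if_neg hB.not_ge, PMF.bind_bind, PMF.pure_bind,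
    PMF.toOuterMeasure_bind_apply]

/-- Halting at a node whose bucket contains `p` is a success, so sampling can only help. -/
theorem child_le_queryTree_node {d : ℕ} (m R : ℕ) {B : Finset (Cube d)} (i : Fin d)
    (l r : HashTree d) (q : Cube d) {p : Cube d} (hp : p ∈ B) :
    (queryTree m R q (if q i = false then l else r)).toOuterMeasure {B | p ∈ B} ≤
      (queryTree m R q (.node B i l r)).toOuterMeasure {B | p ∈ B} := by
  rw [queryTree, PMF.toOuterMeasure_bind_apply]
  set c := (queryTree m R q (if q i = false then l else r)).toOuterMeasure {B | p ∈ B} with hc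
  calc c = ∑' hit, sampleHit m R q B hit * c := by
        rw [ENNReal.tsum_mul_right, PMF.tsum_coe, one_mul]
    _ ≤ _ := by
        refine ENNReal.tsum_le_tsum fun hit => mul_le_mul_right ?_ _
        cases hit with
        | false => simp only [hc]; split_ifs <;> simp_all
        | true => simpa [hp, -PMF.toOuterMeasure_apply_fintype] using PMF.toOuterMeasure_apply_le_one _ _

/-- The points of the bucket that are sampled include `p` itself with probability at least
`1 / |B|`. -/
theorem inv_card_le_sampleHit {d m R : ℕ} (hm : 0 < m) {B : Finset (Cube d)} {q p : Cube d}
    (hp : p ∈ B) (hqp : hammingDist q p ≤ R) : (B.card : ℝ≥0∞)⁻¹ ≤ sampleHit m R q B true := by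
  classical
  have hB : B.Nonempty := ⟨p, hp⟩
  have hB0 : B.card ≠ 0 := hB.card_ne_zero
  obtain ⟨m, rfl⟩ := Nat.exists_eq_succ_of_ne_zero hm.ne'
  rw [sampleHit, dif_pos hB, ← PMF.toOuterMeasure_apply_singleton, PMF.toOuterMeasure_map_apply,
    PMF.toOuterMeasure_uniformOfFinset_apply]
  have h1 : (Fintype.piFinset (Fin.cons {p} fun _ : Fin m => B : Fin (m + 1) → _)).card =
      B.card ^ m := by
    simp [Fintype.card_piFinset, Fin.prod_univ_succ]
  have h2 : B.card ^ m ≤ ((Fintype.piFinset fun _ : Fin (m + 1) => B).filter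
      (· ∈ (fun s => decide (∃ j, hammingDist q (s j) ≤ R)) ⁻¹' {true})).card := by
    rw [← h1]
    refine Finset.card_le_card fun s hs => ?_
    rw [Fintype.mem_piFinset] at hs
    have h0 : s 0 = p := by simpa using hs 0
    simp only [Finset.mem_filter, Fintype.mem_piFinset, Set.mem_preimage, Set.mem_singleton_iff,
      decide_eq_true_eq]
    refine ⟨fun j => ?_, 0, h0 ▸ hqp⟩
    cases j using Fin.cases with
    | zero => exact h0 ▸ hp
    | succ j => simpa using hs j.succ
  rw [Fintype.card_piFinset_const]
  calc (B.card : ℝ≥0∞)⁻¹ = (B.card ^ m : ℕ) / (B.card ^ (m + 1) : ℕ) := by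
        push_cast
        rw [pow_succ, ENNReal.div_eq_inv_mul, ENNReal.mul_inv (by simp) (by simp), mul_right_comm,
          ENNReal.inv_mul_cancel (by simp [hB0]) (by simp [ENNReal.pow_eq_top_iff]), one_mul]
    _ ≤ _ := by gcongr

theorem inv_card_le_queryTree_node {d m R : ℕ} (hm : 0 < m) {B : Finset (Cube d)} (i : Fin d)
    (l r : HashTree d) {q p : Cube d} (hp : p ∈ B) (hqp : hammingDist q p ≤ R) :
    (B.card : ℝ≥0∞)⁻¹ ≤ (queryTree m R q (.node B i l r)).toOuterMeasure {B | p ∈ B} := by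
  rw [queryTree, PMF.toOuterMeasure_bind_apply, tsum_bool]
  refine (inv_card_le_sampleHit hm hp hqp).trans (le_add_left ?_)
  simp [hp, -PMF.toOuterMeasure_apply_fintype]

/-- A query near `p` succeeds with probability at least `1 / |B|`, because it succeeds as soon as
`p` is among the points sampled at the root. -/
theorem inv_card_le_bucketSuccess {d m R : ℕ} (hm : 0 < m) (σ : HashRule d) (C k : ℕ)
    {B : Finset (Cube d)} (A : Finset (Fin d)) {q p : Cube d} (hp : p ∈ B)
    (hqp : hammingDist q p ≤ R) : (B.card : ℝ≥0∞)⁻¹ ≤ bucketSuccess σ C m R k B A q p := by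
  have hB0 : 1 ≤ B.card := Finset.card_pos.2 ⟨p, hp⟩
  have h1 : (B.card : ℝ≥0∞)⁻¹ ≤ 1 := ENNReal.inv_le_one.2 (by exact_mod_cast hB0)
  cases k with
  | zero => rwa [bucketSuccess_zero σ C m R A q hp]
  | succ k =>
    by_cases hB : B.card ≤ C
    · rwa [bucketSuccess_of_card_le σ m R _ A q hp hB]
    rw [bucketSuccess_succ σ m R k A q p (not_le.1 hB)]
    calc (B.card : ℝ≥0∞)⁻¹ = ∑' i, σ B A i *
          ∑' l, buildTree σ C k (side B i false) (A.erase i) l *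
            ∑' r, buildTree σ C k (side B i true) (A.erase i) r * (B.card : ℝ≥0∞)⁻¹ := by
          simp only [ENNReal.tsum_mul_right, PMF.tsum_coe, one_mul]
      _ ≤ _ := by
          gcongr with i l r
          exact inv_card_le_queryTree_node hm i l r hp hqp

/-- If `q` and `p` agree at the coordinate drawn at the root, both move to the same child. -/
theorem sum_child_le_bucketSuccess {d : ℕ} (σ : HashRule d) {C : ℕ} (m R k : ℕ)
    {B : Finset (Cube d)} (A : Finset (Fin d)) (q : Cube d) {p : Cube d} (hp : p ∈ B)
    (hB : C < B.card) :
    ∑ i with p i = q i, σ B A i * bucketSuccess σ C m R k (side B i (p i)) (A.erase i) q p ≤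
      bucketSuccess σ C m R (k + 1) B A q p := by
  rw [bucketSuccess_succ σ m R k A q p hB, tsum_fintype]
  refine (Finset.sum_le_sum fun i hi => ?_).trans
    (Finset.sum_le_univ_sum_of_nonneg fun i => zero_le (a := _))
  gcongr
  have hi : p i = q i := by simpa using hi
  have key : ∀ l r, (queryTree m R q (if q i = false then l else r)).toOuterMeasure {B | p ∈ B} ≤
      (queryTree m R q (.node B i l r)).toOuterMeasure {B | p ∈ B} :=
    fun l r => child_le_queryTree_node m R i l r q hp
  rw [bucketSuccess, PMF.toOuterMeasure_bind_apply, hi]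
  cases hq : q i with
  | false =>
    calc _ = ∑' l, buildTree σ C k (side B i false) (A.erase i) l *
          ∑' r, buildTree σ C k (side B i true) (A.erase i) r *
            (queryTree m R q l).toOuterMeasure {B | p ∈ B} := by
          simp [ENNReal.tsum_mul_right, PMF.tsum_coe]
      _ ≤ _ := by
          gcongr ∑' l, _ * ∑' r, _ * ?_ with l r
          have := key l r
          simp only [hq] at this
          simpa [-PMF.toOuterMeasure_apply_fintype] using this
  | true =>
    calc _ = ∑' l, buildTree σ C k (side B i false) (A.erase i) l *
          ∑' r, buildTree σ C k (side B i true) (A.erase i) r *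
            (queryTree m R q r).toOuterMeasure {B | p ∈ B} := by
          rw [ENNReal.tsum_mul_right, PMF.tsum_coe, one_mul]
      _ ≤ _ := by
          gcongr ∑' l, _ * ∑' r, _ * ?_ with l r
          have := key l r
          simp only [hq] at this
          simpa [-PMF.toOuterMeasure_apply_fintype] using this

/-! ### Near-optimal distributions are spread out -/

theorem card_side_add {d : ℕ} (B : Finset (Cube d)) (i : Fin d) :
    (side B i true).card + (side B i false).card = B.card := by
  have := Finset.card_filter_add_card_filter_not (s := B) (fun x => x i = true)
  simpa [side] using this

theorem worstPayoff_le {d r : ℕ} {ρ : ℝ} {B : Finset (Cube d)} {π : PMF (Fin d)} {q p : Cube d}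
    (hp : p ∈ B) (hqp : hammingDist q p ≤ r) : worstPayoff r ρ B π ≤ payoff ρ B π q p :=
  ciInf_le (Set.finite_range fun y : {y : Cube d × Cube d // y.2 ∈ B ∧ hammingDist y.1 y.2 ≤ r} =>
    payoff ρ B π y.1.1 y.1.2).bddBelow ⟨(q, p), hp, hqp⟩

theorem le_worstPayoff {d r : ℕ} {ρ V : ℝ} {B : Finset (Cube d)} {π : PMF (Fin d)}
    (hB : B.Nonempty)
    (h : ∀ q p, p ∈ B → hammingDist q p ≤ r → V ≤ payoff ρ B π q p) : V ≤ worstPayoff r ρ B π := by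
  obtain ⟨p, hp⟩ := hB
  have : Nonempty {y : Cube d × Cube d // y.2 ∈ B ∧ hammingDist y.1 y.2 ≤ r} :=
    ⟨⟨(p, p), hp, by simp⟩⟩
  exact le_ciInf fun y => h _ _ y.2.1 y.2.2

/-- Two numbers of sum `N` satisfy `x ^ (1 - ρ) + y ^ (1 - ρ) ≤ 2 ^ ρ * N ^ (1 - ρ)`. -/
theorem rpow_add_rpow_le {ρ x y : ℝ} (h0 : 0 ≤ ρ) (h1 : ρ ≤ 1) (hx : 0 ≤ x) (hy : 0 ≤ y) :
    x ^ (1 - ρ) + y ^ (1 - ρ) ≤ 2 ^ ρ * (x + y) ^ (1 - ρ) := by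
  have h := (Real.concaveOn_rpow (p := 1 - ρ) (by linarith) (by linarith)).2
    (Set.mem_Ici.2 hx) (Set.mem_Ici.2 hy) (by norm_num : (0 : ℝ) ≤ 1 / 2)
    (by norm_num : (0 : ℝ) ≤ 1 / 2) (by norm_num)
  simp only [smul_eq_mul] at h
  rw [← mul_add, ← mul_add, Real.mul_rpow (by norm_num) (by positivity)] at h
  have h2 : (2 : ℝ) * (1 / 2) ^ (1 - ρ) = 2 ^ ρ := by
    rw [one_div, Real.inv_rpow (by norm_num), ← Real.rpow_neg (by norm_num)]
    nth_rewrite 1 [← Real.rpow_one 2]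
    rw [← Real.rpow_add (by norm_num)]
    congr 1; ring
  rw [← h2]
  linarith

/-- On average over the points of the bucket, the weight `n_{i, p i} ^ (-ρ)` of a coordinate is at
most that of a coordinate which halves the bucket. -/
theorem sum_card_side_rpow_le {d : ℕ} {ρ : ℝ} (h0 : 0 ≤ ρ) (h1 : ρ < 1) (B : Finset (Cube d))
    (i : Fin d) :
    ∑ p ∈ B, ((side B i (p i)).card : ℝ) ^ (-ρ) ≤ 2 ^ ρ * (B.card : ℝ) ^ (1 - ρ) := by
  have key : ∀ b : Bool, ∑ p ∈ side B i b, ((side B i (p i)).card : ℝ) ^ (-ρ) =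
      ((side B i b).card : ℝ) ^ (1 - ρ) := fun b => by
    have hc : ∀ p ∈ side B i b, ((side B i (p i)).card : ℝ) ^ (-ρ) =
        ((side B i b).card : ℝ) ^ (-ρ) := fun p hp => by rw [(Finset.mem_filter.1 hp).2]
    rw [Finset.sum_congr rfl hc, Finset.sum_const, nsmul_eq_mul, sub_eq_add_neg,
      Real.rpow_one_add' (by positivity) (by linarith)]
  have hs : ∑ p ∈ B, ((side B i (p i)).card : ℝ) ^ (-ρ) =
      ((side B i true).card : ℝ) ^ (1 - ρ) + ((side B i false).card : ℝ) ^ (1 - ρ) := by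
    rw [← key, ← key, ← Finset.sum_filter_add_sum_filter_not B (fun x => x i = true)]
    simp [side]
  rw [hs, ← card_side_add B i]
  push_cast
  exact rpow_add_rpow_le h0 h1.le (by positivity) (by positivity)

/-- A distribution whose worst payoff is large gives little mass to every set `Q` of `r`
coordinates: average the payoff over the pairs `(q, p)` where `q` is `p` flipped on `Q`. -/
theorem worstPayoff_le_mass {d r : ℕ} {ρ : ℝ} (h0 : 0 ≤ ρ) (h1 : ρ < 1) {B : Finset (Cube d)}
    (hB : B.Nonempty) (π : PMF (Fin d)) {Q : Finset (Fin d)} (hQ : Q.card ≤ r) :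
    worstPayoff r ρ B π ≤ (∑ i with i ∉ Q, (π i).toReal) * (2 ^ ρ * (B.card : ℝ) ^ (-ρ)) := by
  have hBpos : (0 : ℝ) < B.card := by exact_mod_cast hB.card_pos
  have hpay : ∀ p ∈ B, worstPayoff r ρ B π ≤
      ∑ i with i ∉ Q, (π i).toReal * ((side B i (p i)).card : ℝ) ^ (-ρ) := fun p hp => by
    have hd : hammingDist (fun i => if i ∈ Q then !p i else p i) p ≤ r := by
      refine le_trans ?_ hQ
      refine Finset.card_le_card fun i hi => ?_
      by_contra hiQ
      simp [hiQ] at hi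
    refine (worstPayoff_le hp hd).trans_eq ?_
    rw [payoff, Finset.sum_filter]
    refine Finset.sum_congr rfl fun i _ => ?_
    by_cases hi : i ∈ Q <;> simp [hi]
  have hsum := Finset.sum_le_sum hpay
  rw [Finset.sum_const, nsmul_eq_mul, Finset.sum_comm] at hsum
  have h2 : (B.card : ℝ) * worstPayoff r ρ B π ≤
      (∑ i with i ∉ Q, (π i).toReal) * (2 ^ ρ * (B.card : ℝ) ^ (1 - ρ)) := by
    refine hsum.trans ?_
    rw [Finset.sum_mul]
    refine Finset.sum_le_sum fun i _ => ?_
    rw [← Finset.mul_sum]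
    exact mul_le_mul_of_nonneg_left (sum_card_side_rpow_le h0 h1 B i) ENNReal.toReal_nonneg
  rw [sub_eq_add_neg, Real.rpow_add hBpos, Real.rpow_one] at h2
  refine le_of_mul_le_mul_left (h2.trans_eq ?_) hBpos
  ring

/-- The worst payoff of the uniform distribution over coordinates which split the bucket evenly. -/
theorem le_worstPayoff_uniform {d r : ℕ} {ρ M : ℝ} (h0 : 0 ≤ ρ) {B : Finset (Cube d)}
    (hB : B.Nonempty) {A : Finset (Fin d)} (hA : A.Nonempty)
    (hM : ∀ i ∈ A, ∀ b, ((side B i b).card : ℝ) ≤ M) :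
    (1 - r / A.card) * M ^ (-ρ) ≤ worstPayoff r ρ B (PMF.uniformOfFinset A hA) := by
  have hApos : (0 : ℝ) < A.card := by exact_mod_cast hA.card_pos
  have hM0 : 0 ≤ M := (Nat.cast_nonneg _).trans (hM _ hA.choose_spec true)
  refine le_worstPayoff hB fun q p hp hqp => ?_
  have hcard : (A.card : ℝ) - r ≤ (A.filter fun i => p i = q i).card := by
    have h1 := Finset.card_filter_add_card_filter_not (s := A) (fun i => p i = q i)
    have h2 : (A.filter fun i => ¬ p i = q i).card ≤ r := by
      refine le_trans (Finset.card_le_card fun i hi => ?_) hqp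
      simp only [Finset.mem_filter, Finset.mem_univ, true_and] at hi ⊢
      exact fun h => hi.2 h.symm
    have h3 : (A.card : ℝ) ≤ (A.filter fun i => p i = q i).card + r := by
      exact_mod_cast h1.symm.le.trans (by gcongr)
    linarith
  have hterm : ∀ i ∈ A.filter (fun i => p i = q i), (A.card : ℝ)⁻¹ * M ^ (-ρ) ≤
      (PMF.uniformOfFinset A hA i).toReal *
        (if p i = q i then ((side B i (p i)).card : ℝ) ^ (-ρ) else 0) := fun i hi => by
    rw [Finset.mem_filter] at hi
    rw [PMF.uniformOfFinset_apply_of_mem hA hi.1, if_pos hi.2, ENNReal.toReal_inv,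
      ENNReal.toReal_natCast]
    have hpos : (0 : ℝ) < (side B i (p i)).card := by
      have : (side B i (p i)).Nonempty := ⟨p, Finset.mem_filter.2 ⟨hp, rfl⟩⟩
      exact_mod_cast this.card_pos
    exact mul_le_mul_of_nonneg_left
      (Real.rpow_le_rpow_of_nonpos hpos (hM i hi.1 _) (by linarith)) (by positivity)
  calc (1 - r / A.card) * M ^ (-ρ) = (A.card - r) * ((A.card : ℝ)⁻¹ * M ^ (-ρ)) := by field_simp
    _ ≤ (A.filter fun i => p i = q i).card * ((A.card : ℝ)⁻¹ * M ^ (-ρ)) := by gcongr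
    _ ≤ ∑ i ∈ A.filter (fun i => p i = q i), (PMF.uniformOfFinset A hA i).toReal *
        (if p i = q i then ((side B i (p i)).card : ℝ) ^ (-ρ) else 0) := by
      rw [← nsmul_eq_mul]
      exact Finset.card_nsmul_le_sum _ _ _ hterm
    _ ≤ payoff ρ B (PMF.uniformOfFinset A hA) q p :=
      Finset.sum_le_univ_sum_of_nonneg fun i => by positivity

/-- Near-optimality bounds the mass of every set `Q` of at most `r` coordinates, as soon as enough
unused coordinates split the bucket almost evenly. No coordinate can beat an even split on average,
so near-optimality leaves no room for avoiding the coordinates outside `Q`. -/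
theorem IsMaxMin.le_mass {d r : ℕ} {ρ ε η : ℝ} (h0 : 0 ≤ ρ) (h1 : ρ < 1) (hη : 0 ≤ η)
    (hε : 0 ≤ ε) {B : Finset (Cube d)} (hB : B.Nonempty) {A A' : Finset (Fin d)} (hA' : A' ⊆ A)
    (hne : A'.Nonempty) (hr : r ≤ A'.card)
    (hM : ∀ i ∈ A', ∀ b, ((side B i b).card : ℝ) ≤ (1 / 2 + η) * B.card) {π : PMF (Fin d)}
    (hπ : IsMaxMin r ρ ε B A π) {Q : Finset (Fin d)} (hQ : Q.card ≤ r) :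
    1 - r / A'.card - 2 * η - ε * B.card ≤ ∑ i with i ∉ Q, (π i).toReal := by
  have hBpos : (1 : ℝ) ≤ B.card := by exact_mod_cast hB.card_pos
  have hApos : (0 : ℝ) < A'.card := by exact_mod_cast hne.card_pos
  have hra : (r : ℝ) / A'.card ≤ 1 := by
    rw [div_le_one hApos]; exact_mod_cast hr
  have hmass := worstPayoff_le_mass h0 h1 hB π hQ
  have htest := le_worstPayoff_uniform (r := r) h0 hB hne hM
  -- On `A'` both sides have at most `(1 / 2 + η) |B|` points, so the uniform distribution on `A'`
  -- almost attains `2 ^ ρ * |B| ^ (-ρ)`, which `hmass` shows to be the best possible worst payoff.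
  have hopt := hπ.2 (PMF.uniformOfFinset A' hne) (by
    rw [PMF.support_uniformOfFinset]; exact_mod_cast hA')
  set S := ∑ i with i ∉ Q, (π i).toReal
  have hsplit : ((1 / 2 + η) * (B.card : ℝ)) ^ (-ρ) =
      (1 + 2 * η) ^ (-ρ) * (2 ^ ρ * (B.card : ℝ) ^ (-ρ)) := by
    have : (1 / 2 + η) * (B.card : ℝ) = (1 + 2 * η) * (2⁻¹ * B.card) := by ring
    rw [this, Real.mul_rpow (by positivity) (by positivity),
      Real.mul_rpow (by positivity) (by positivity), Real.inv_rpow (by positivity),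
      Real.rpow_neg (x := 2) (by positivity), inv_inv]
  have hη' : 1 - 2 * η ≤ (1 + 2 * η) ^ (-ρ) := by
    have h3 : (1 + 2 * η) ^ (-1 : ℝ) ≤ (1 + 2 * η) ^ (-ρ) :=
      Real.rpow_le_rpow_of_exponent_le (by linarith) (by linarith)
    refine le_trans ?_ h3
    rw [Real.rpow_neg_one, ← one_div, le_div_iff₀ (by positivity)]
    nlinarith
  set W := (2 : ℝ) ^ ρ * (B.card : ℝ) ^ (-ρ) with hW
  have hWpos : 0 < W := by positivity
  have hWB : 1 ≤ W * B.card := by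
    rw [hW, mul_assoc, ← Real.rpow_add_one (by positivity)]
    exact one_le_mul_of_one_le_of_one_le (Real.one_le_rpow (by norm_num) h0)
      (Real.one_le_rpow hBpos (by linarith))
  rw [hsplit] at htest
  have h4 : (1 - r / A'.card) * (1 - 2 * η) * W ≤ S * W + ε * (W * B.card) := by
    calc (1 - r / A'.card) * (1 - 2 * η) * W
        ≤ (1 - r / A'.card) * ((1 + 2 * η) ^ (-ρ) * W) := by
          rw [mul_assoc]
          gcongr
      _ ≤ S * W + ε := by linarith
      _ ≤ S * W + ε * (W * B.card) := by gcongr; exact le_mul_of_one_le_right hε hWB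
  have h5 : (1 - r / A'.card) * (1 - 2 * η) ≤ S + ε * B.card :=
    le_of_mul_le_mul_right (h4.trans_eq (by ring)) hWpos
  have h6 : 0 ≤ (r : ℝ) / A'.card * η := by positivity
  nlinarith

/-! ### From a balanced dataset to a lower bound for the success probability -/

/-- The points of `P` in the subcube cut out by the constraints `x i = b` for `(i, b) ∈ T`. Every
bucket of a hash tree over `P` is of this form. -/
def subcube {d : ℕ} (P : Finset (Cube d)) (T : Finset (Fin d × Bool)) : Finset (Cube d) :=
  P.filter fun x => ∀ e ∈ T, x e.1 = e.2

/-- The coordinates which the constraints `T` leave free. -/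
def free {d : ℕ} (T : Finset (Fin d × Bool)) : Finset (Fin d) :=
  Finset.univ \ T.image Prod.fst

theorem side_subcube {d : ℕ} (P : Finset (Cube d)) (T : Finset (Fin d × Bool)) (i : Fin d)
    (b : Bool) : side (subcube P T) i b = subcube P (insert (i, b) T) := by
  ext x
  simp only [side, subcube, Finset.mem_filter, Finset.forall_mem_insert]
  tauto

theorem free_erase {d : ℕ} (T : Finset (Fin d × Bool)) (i : Fin d) (b : Bool) :
    (free T).erase i = free (insert (i, b) T) := by
  ext j
  simp only [free, Finset.mem_erase, Finset.mem_sdiff, Finset.mem_univ, true_and,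
    Finset.image_insert, Finset.mem_insert]
  tauto

/-- Every bucket of more than `d` points, cut out by at most `K` constraints, is split by every free
coordinate into parts of at most four fifths of its size, and almost evenly by the coordinates
off `S₁`. -/
def IsBalanced {d : ℕ} (P : Finset (Cube d)) (S₁ : Finset (Fin d)) (K : ℕ) (η : ℝ) : Prop :=
  ∀ T : Finset (Fin d × Bool), T.card ≤ K → d < (subcube P T).card → ∀ i ∈ free T, ∀ b,
    ((side (subcube P T) i b).card : ℝ) ≤ 4 / 5 * (subcube P T).card ∧
      (i ∉ S₁ → ((side (subcube P T) i b).card : ℝ) ≤ (1 / 2 + η) * (subcube P T).card)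

theorem le_card_free_sdiff {d K : ℕ} {S₁ : Finset (Fin d)} (hS : 2 * S₁.card = d)
    {T : Finset (Fin d × Bool)} (hT : T.card ≤ K) : d ≤ 2 * ((free T \ S₁).card + K) := by
  have h1 : d ≤ (free T \ S₁).card + (T.card + S₁.card) := by
    calc d = (Finset.univ : Finset (Fin d)).card := by simp
      _ ≤ ((free T \ S₁) ∪ (T.image Prod.fst ∪ S₁)).card := by
        refine Finset.card_le_card fun i _ => ?_
        simp only [free, Finset.mem_union, Finset.mem_sdiff, Finset.mem_univ, true_and]
        tauto
      _ ≤ _ := (Finset.card_union_le _ _).trans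
        (by gcongr; exact (Finset.card_union_le _ _).trans (by gcongr; exact Finset.card_image_le))
  omega

/-- The success probability in a tree over a balanced dataset. Each of the `t` levels on which
buckets have more than `d` points loses a factor `1 - δ`; at a bucket of at most `d` points, one
sampling step finds `p` itself with probability at least `1 / d`. -/
theorem IsBalanced.le_bucketSuccess {d r R m K : ℕ} {ρ ε η δ : ℝ} {P : Finset (Cube d)}
    {S₁ : Finset (Fin d)} {σ : HashRule d} (hP : IsBalanced P S₁ K η) (hd : 0 < d)
    (hS : 2 * S₁.card = d) (hK : 6 * K ≤ d) (hr : 3 * r ≤ d) (hrR : r ≤ R) (hm : 0 < m)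
    (h0 : 0 ≤ ρ) (h1 : ρ < 1) (hη : 0 ≤ η) (hε : 0 ≤ ε)
    (hδ : 3 * r / d + 2 * η + ε * P.card ≤ δ) (hδ1 : δ ≤ 1)
    (hσ : IsOptimizedRule r 1 ρ ε σ) {q p : Cube d} (hqp : hammingDist q p ≤ r) (t : ℕ) :
    ∀ (k : ℕ) (T : Finset (Fin d × Bool)), T.card + t ≤ K →
      ((subcube P T).card : ℝ) ≤ d * (5 / 4) ^ t → p ∈ subcube P T →
      ENNReal.ofReal ((1 - δ) ^ t / d) ≤
        bucketSuccess σ 1 m R k (subcube P T) (free T) q p := by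
  have hdR : (0 : ℝ) < d := by exact_mod_cast hd
  have hδ0 : 0 ≤ δ := le_trans (by positivity) hδ
  have small : ∀ (t k : ℕ) (T : Finset (Fin d × Bool)), (subcube P T).card ≤ d →
      p ∈ subcube P T → ENNReal.ofReal ((1 - δ) ^ t / d) ≤
        bucketSuccess σ 1 m R k (subcube P T) (free T) q p := fun t k T hB hp => by
    refine le_trans ?_ (inv_card_le_bucketSuccess hm σ 1 k (free T) hp (hqp.trans hrR))
    calc ENNReal.ofReal ((1 - δ) ^ t / d) ≤ ENNReal.ofReal ((d : ℝ)⁻¹) := by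
          refine ENNReal.ofReal_le_ofReal ?_
          rw [div_eq_mul_inv]
          exact mul_le_of_le_one_left (by positivity)
            (pow_le_one₀ (by linarith) (by linarith))
      _ = (d : ℝ≥0∞)⁻¹ := by rw [ENNReal.ofReal_inv_of_pos hdR, ENNReal.ofReal_natCast]
      _ ≤ _ := ENNReal.inv_le_inv.2 (by exact_mod_cast hB)
  induction t with
  | zero =>
    intro k T _ hB hp
    exact small 0 k T (by simpa using hB) hp
  | succ t ih =>
    intro k T hT hB hp
    by_cases hcard : (subcube P T).card ≤ d
    · exact small _ k T hcard hp
    rw [not_le] at hcard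
    have hle1 : (1 - δ) ^ (t + 1) / d ≤ 1 := by
      rw [div_le_one hdR]
      exact (pow_le_one₀ (by linarith) (by linarith)).trans (by exact_mod_cast hd)
    cases k with
    | zero =>
      rw [bucketSuccess_zero σ 1 m R _ q hp]
      exact ENNReal.ofReal_le_one.2 hle1
    | succ k =>
      have hfree := le_card_free_sdiff hS (show T.card ≤ K by omega)
      have h3 : d ≤ 3 * (free T \ S₁).card := by omega
      have hne : (free T \ S₁).Nonempty := Finset.card_pos.1 (by omega)
      have hopt : IsMaxMin r ρ ε (subcube P T) (free T) (σ (subcube P T) (free T)) := by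
        have := hσ (subcube P T) (free T) (by omega) (hne.mono Finset.sdiff_subset)
        rwa [nodeExponent, if_pos hcard] at this
      set π := σ (subcube P T) (free T) with hπ
      have hmass : 1 - δ ≤ ∑ i with p i = q i, (π i).toReal := by
        have hbal := hP T (by omega) hcard
        have h := IsMaxMin.le_mass h0 h1 hη hε ⟨p, hp⟩ Finset.sdiff_subset hne (by omega)
          (fun i hi b => (hbal i (Finset.mem_sdiff.1 hi).1 b).2 (Finset.mem_sdiff.1 hi).2) hopt
          (Q := Finset.univ.filter fun i => q i ≠ p i) hqp
        have hr3 : (r : ℝ) / (free T \ S₁).card ≤ 3 * r / d := by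
          rw [div_le_div_iff₀ (by exact_mod_cast hne.card_pos) hdR]
          have h3' : (d : ℝ) ≤ 3 * (free T \ S₁).card := by exact_mod_cast h3
          nlinarith [Nat.cast_nonneg (α := ℝ) r]
        have hεB : ε * (subcube P T).card ≤ ε * P.card := by
          gcongr
          exact Finset.filter_subset _ _
        have hset : (Finset.univ.filter fun i => i ∉ Finset.univ.filter fun i => q i ≠ p i) =
            Finset.univ.filter fun i => p i = q i := by
          ext i; simp [eq_comm]
        rw [hset] at h
        linarith
      refine le_trans ?_ (sum_child_le_bucketSuccess σ m R k (free T) q hp (by omega))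
      have hc : (0 : ℝ) ≤ (1 - δ) ^ t / d :=
        div_nonneg (pow_nonneg (by linarith) _) hdR.le
      calc ENNReal.ofReal ((1 - δ) ^ (t + 1) / d)
          = ENNReal.ofReal (1 - δ) * ENNReal.ofReal ((1 - δ) ^ t / d) := by
            rw [← ENNReal.ofReal_mul (by linarith)]; congr 1; ring
        _ ≤ ENNReal.ofReal (∑ i with p i = q i, (π i).toReal) *
              ENNReal.ofReal ((1 - δ) ^ t / d) := by gcongr
        _ = ∑ i with p i = q i, π i * ENNReal.ofReal ((1 - δ) ^ t / d) := by
            rw [ENNReal.ofReal_sum_of_nonneg fun i _ => ENNReal.toReal_nonneg, Finset.sum_mul]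
            simp [ENNReal.ofReal_toReal (π.apply_ne_top _)]
        _ ≤ _ := by
            refine Finset.sum_le_sum fun i _ => ?_
            by_cases hi : i ∈ free T
            · gcongr
              rw [side_subcube, free_erase T i (p i)]
              refine ih k _ ?_ ?_ ?_
              · have := Finset.card_insert_le (i, p i) T
                omega
              · rw [← side_subcube]
                refine ((hP T (by omega) hcard i hi (p i)).1).trans ?_
                rw [pow_succ] at hB
                linarith
              · rw [← side_subcube]
                exact Finset.mem_filter.2 ⟨hp, rfl⟩
            · have : π i = 0 := by
                by_contra h
                exact hi (hopt.1 ((PMF.mem_support_iff _ _).2 h))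
              simp [this]

/-- The success probability of the tree over a balanced dataset. -/
theorem IsBalanced.le_treeSuccess {d r R m K : ℕ} {ρ ε η δ : ℝ} {P : Finset (Cube d)}
    {S₁ : Finset (Fin d)} {σ : HashRule d} (hP : IsBalanced P S₁ K η) (hd : 0 < d)
    (hS : 2 * S₁.card = d) (hK : 6 * K ≤ d) (hr : 3 * r ≤ d) (hrR : r ≤ R) (hm : 0 < m)
    (h0 : 0 ≤ ρ) (h1 : ρ < 1) (hη : 0 ≤ η) (hε : 0 ≤ ε)
    (hδ : 3 * r / d + 2 * η + ε * P.card ≤ δ) (hδ1 : δ ≤ 1)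
    (hσ : IsOptimizedRule r 1 ρ ε σ) (hcard : (P.card : ℝ) ≤ d * (5 / 4) ^ K) :
    ENNReal.ofReal ((1 - δ) ^ K / d) ≤ minSuccess P r (treeSuccess σ 1 m R P) := by
  refine le_iInf fun p => le_iInf fun hp => le_iInf fun q => le_iInf fun hqp => ?_
  have hsub : subcube P ∅ = P := by simp [subcube]
  have h := hP.le_bucketSuccess hd hS hK hr hrR hm h0 h1 hη hε hδ hδ1 hσ hqp K d ∅ (by simp)
    (by rwa [hsub]) (by rwa [hsub])
  rwa [hsub, show free (∅ : Finset (Fin d × Bool)) = Finset.univ by simp [free]] at h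

/-! ### Counting points of subcubes: a Chernoff bound -/

theorem exp_le_one_add_add_sq {x : ℝ} (hx : |x| ≤ 1) : Real.exp x ≤ 1 + x + x ^ 2 := by
  have := (abs_le.1 (Real.abs_exp_sub_one_sub_id_le hx)).2
  linarith

/-- The exponential moment of a centered bit, corrected by the square of the exponent. -/
theorem integral_exp_bit_le (ν : Measure Bool) [IsProbabilityMeasure ν] (c : Bool) {l : ℝ}
    (h0 : 0 ≤ l) (h1 : l ≤ 1) :
    ∫ b, Real.exp (l * ((if b = c then 1 else 0) - ν.real {c}) - l ^ 2) ∂ν ≤ 1 := by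
  set e := ν.real {c} with he
  have he0 : 0 ≤ e := measureReal_nonneg
  have he1 : e ≤ 1 := measureReal_le_one
  have hc : ν.real {!c} = 1 - e := by
    rw [he, ← probReal_compl_eq_one_sub (MeasurableSet.singleton c)]
    congr 1
    ext b; cases b <;> cases c <;> simp
  have hE : Real.exp (l ^ 2) * Real.exp (-l ^ 2) = 1 := by rw [← Real.exp_add]; simp
  have hl2 := Real.add_one_le_exp (l ^ 2)
  have hpos := Real.exp_pos (-l ^ 2)
  have b1 : Real.exp (l * (1 - e)) ≤ 1 + l * (1 - e) + l ^ 2 := by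
    refine (exp_le_one_add_add_sq ?_).trans ?_
    · rw [abs_of_nonneg (by nlinarith)]; nlinarith
    · have : (l * (1 - e)) ^ 2 ≤ l ^ 2 := pow_le_pow_left₀ (by nlinarith) (by nlinarith) 2
      linarith
  have b2 : Real.exp (l * (0 - e)) ≤ 1 + l * (0 - e) + l ^ 2 := by
    refine (exp_le_one_add_add_sq ?_).trans ?_
    · rw [abs_le]; constructor <;> nlinarith
    · have : (l * e) ^ 2 ≤ l ^ 2 := pow_le_pow_left₀ (by nlinarith) (by nlinarith) 2
      nlinarith
  have hint : ∫ b, Real.exp (l * ((if b = c then 1 else 0) - e) - l ^ 2) ∂ν =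
      (e * Real.exp (l * (1 - e)) + (1 - e) * Real.exp (l * (0 - e))) * Real.exp (-l ^ 2) := by
    rw [integral_fintype Integrable.of_finite, Fintype.sum_bool]
    simp only [sub_eq_add_neg _ (l ^ 2), Real.exp_add, smul_eq_mul]
    cases c
    · rw [← he, show ν.real {true} = 1 - e from hc]
      simp only [reduceCtorEq, if_true, if_false]; ring
    · rw [← he, show ν.real {false} = 1 - e from hc]
      simp only [reduceCtorEq, if_true, if_false]; ring
  rw [hint]
  refine le_trans (mul_le_mul_of_nonneg_right ?_ hpos.le) hE.le
  nlinarith [mul_le_mul_of_nonneg_left b1 he0, mul_le_mul_of_nonneg_left b2 (sub_nonneg.2 he1)]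

/-- Whether a point lies in the subcube cut out by `T` is independent of its bit at a free
coordinate `i`, so that conditioning on the subcube does not affect the exponential moment. -/
theorem integral_exp_subcube_le {d : ℕ} (ν : Fin d → Measure Bool)
    [∀ i, IsProbabilityMeasure (ν i)] {T : Finset (Fin d × Bool)} {i : Fin d} (hi : i ∈ free T)
    (c : Bool) {l : ℝ} (h0 : 0 ≤ l) (h1 : l ≤ 1) :
    ∫ x, Real.exp (if ∀ e ∈ T, x e.1 = e.2 then
      l * ((if x i = c then 1 else 0) - (ν i).real {c}) - l ^ 2 else 0) ∂Measure.pi ν ≤ 1 := by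
  -- The exponential is `1 + ∏ j, φ j (x j)`: the factors `j ≠ i` make up the indicator of the
  -- subcube, and the factor at `i` is the exponential of the centered bit, minus `1`.
  set φ : Fin d → Bool → ℝ := fun j b =>
    if j = i then Real.exp (l * ((if b = c then 1 else 0) - (ν i).real {c}) - l ^ 2) - 1
    else if ∀ e ∈ T, e.1 = j → b = e.2 then 1 else 0 with hφ
  have hiT : ∀ e ∈ T, e.1 ≠ i := fun e he h => by
    simp only [free, Finset.mem_sdiff, Finset.mem_univ, true_and, Finset.mem_image] at hi
    exact hi ⟨e, he, h⟩
  have hpt : ∀ x : Fin d → Bool, Real.exp (if ∀ e ∈ T, x e.1 = e.2 then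
      l * ((if x i = c then 1 else 0) - (ν i).real {c}) - l ^ 2 else 0) = 1 + ∏ j, φ j (x j) := by
    intro x
    rw [← Finset.mul_prod_erase _ _ (Finset.mem_univ i)]
    have hprod : ∏ j ∈ Finset.univ.erase i, φ j (x j) = if ∀ e ∈ T, x e.1 = e.2 then 1 else 0 := by
      have : ∀ j ∈ Finset.univ.erase i, φ j (x j) =
          if ∀ e ∈ T, e.1 = j → x j = e.2 then 1 else 0 := fun j hj => by
        simp only [hφ, if_neg (Finset.ne_of_mem_erase hj)]
      rw [Finset.prod_congr rfl this]
      by_cases hT : ∀ e ∈ T, x e.1 = e.2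
      · rw [if_pos hT]
        exact Finset.prod_eq_one fun j _ => if_pos fun e he hej => hej ▸ hT e he
      · rw [if_neg hT]
        push Not at hT
        obtain ⟨e, he, hne⟩ := hT
        exact Finset.prod_eq_zero (Finset.mem_erase.2 ⟨hiT e he, Finset.mem_univ _⟩)
          (if_neg fun h => hne (h e he rfl))
    rw [hprod]
    by_cases hT : ∀ e ∈ T, x e.1 = e.2
    · simp only [if_pos hT, hφ, if_true]; ring
    · simp only [if_neg hT]; simp
  simp_rw [hpt]
  rw [integral_add Integrable.of_finite Integrable.of_finite, integral_fintype_prod_eq_prod,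
    ← Finset.mul_prod_erase _ _ (Finset.mem_univ i)]
  have hφi : ∫ b, φ i b ∂ν i ≤ 0 := by
    have h : ∫ b, φ i b ∂ν i = ∫ b, (Real.exp (l * ((if b = c then 1 else 0) - (ν i).real {c})
        - l ^ 2) - 1) ∂ν i := by simp [hφ]
    rw [h, integral_sub Integrable.of_finite Integrable.of_finite]
    rw [integral_const, probReal_univ, one_smul]
    exact sub_nonpos.2 (integral_exp_bit_le (ν i) c h0 h1)
  have hrest : 0 ≤ ∏ j ∈ Finset.univ.erase i, ∫ b, φ j b ∂ν j := by
    refine Finset.prod_nonneg fun j hj => integral_nonneg fun b => ?_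
    simp only [hφ, if_neg (Finset.ne_of_mem_erase hj), Pi.zero_apply]
    split_ifs <;> norm_num
  simpa using mul_nonpos_of_nonpos_of_nonneg hφi hrest

/-- The number of the points `x j` which satisfy the constraints `T`. -/
def count {d N : ℕ} (x : Fin N → Cube d) (T : Finset (Fin d × Bool)) : ℕ :=
  (Finset.univ.filter fun j => ∀ e ∈ T, x j e.1 = e.2).card

/-- Among independent points with independent coordinates, it is unlikely that a subcube holds many
points and an excessive share of them has the bit `c` at a free coordinate. -/
theorem measure_count_le {d N : ℕ} (ν : Fin d → Measure Bool)
    [∀ i, IsProbabilityMeasure (ν i)] {T : Finset (Fin d × Bool)} {i : Fin d} (hi : i ∈ free T)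
    (c : Bool) {h M : ℝ} (h0 : 0 ≤ h) (h1 : h ≤ 1) :
    (Measure.pi fun _ : Fin N => Measure.pi ν) {x | M ≤ count x T ∧
      ((ν i).real {c} + h) * count x T < count x (insert (i, c) T)} ≤
      ENNReal.ofReal (Real.exp (-(h ^ 2 / 4 * M))) := by
  set e := (ν i).real {c} with he
  -- The exponent `h / 2` maximizes the gain `l * h - l ^ 2` per point of the subcube.
  set w : Cube d → ℝ := fun x => if ∀ e ∈ T, x e.1 = e.2 then
      h / 2 * ((if x i = c then 1 else 0) - e) - (h / 2) ^ 2 else 0 with hw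
  set μ := Measure.pi fun _ : Fin N => Measure.pi ν
  have hW : ∀ x : Fin N → Cube d, ∑ j, w (x j) =
      h / 2 * (count x (insert (i, c) T) - e * count x T) - (h / 2) ^ 2 * count x T := by
    intro x
    have h1 : (count x T : ℝ) = ∑ j, if ∀ e ∈ T, x j e.1 = e.2 then 1 else 0 := by
      rw [count, Finset.sum_boole]
    have h2 : (count x (insert (i, c) T) : ℝ) =
        ∑ j, if ∀ e ∈ T, x j e.1 = e.2 then (if x j i = c then 1 else 0) else 0 := by
      rw [count, ← Finset.sum_boole]
      refine Finset.sum_congr rfl fun j _ => ?_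
      simp only [Finset.forall_mem_insert, ite_and]
      split_ifs <;> rfl
    rw [h1, h2, Finset.mul_sum, ← Finset.sum_sub_distrib, Finset.mul_sum, Finset.mul_sum,
      ← Finset.sum_sub_distrib]
    refine Finset.sum_congr rfl fun j _ => ?_
    simp only [hw]
    split_ifs <;> ring
  have hmgf : mgf (fun x => ∑ j, w (x j)) μ 1 ≤ 1 := by
    simp only [mgf, one_mul, Real.exp_sum]
    rw [integral_fintype_prod_eq_prod (fun _ x => Real.exp (w x))]
    refine Finset.prod_le_one (fun j _ => integral_nonneg fun x => (Real.exp_pos _).le)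
      fun j _ => ?_
    exact integral_exp_subcube_le ν hi c (by linarith) (by linarith)
  have hmarkov := measure_ge_le_exp_mul_mgf (μ := μ) (X := fun x => ∑ j, w (x j))
    (h ^ 2 / 4 * M) zero_le_one Integrable.of_finite
  calc μ {x | M ≤ count x T ∧ (e + h) * count x T < count x (insert (i, c) T)}
      ≤ μ {x | h ^ 2 / 4 * M ≤ ∑ j, w (x j)} := by
        refine measure_mono fun x hx => ?_
        simp only [Set.mem_ofPred_eq, hW] at hx ⊢
        nlinarith [mul_le_mul_of_nonneg_left hx.1 (sq_nonneg h),
          mul_le_mul_of_nonneg_left hx.2.le h0]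
    _ = ENNReal.ofReal (μ.real {x | h ^ 2 / 4 * M ≤ ∑ j, w (x j)}) := by
        rw [ofReal_measureReal]
    _ ≤ _ := by
        refine ENNReal.ofReal_le_ofReal (hmarkov.trans ?_)
        rw [neg_one_mul]
        exact mul_le_of_le_one_right (Real.exp_pos _).le hmgf

/-! ### Distinctness of the data points -/

theorem prod_diagonal_le {α : Type*} [Finite α] [MeasurableSpace α] [DiscreteMeasurableSpace α]
    (μ ν : Measure α) [IsProbabilityMeasure μ] [IsProbabilityMeasure ν] {a : ℝ≥0∞}
    (h : ∀ y, μ {y} ≤ a) : (μ.prod ν) {p | p.1 = p.2} ≤ a := by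
  rw [Measure.prod_apply_symm (Set.toFinite _).measurableSet]
  calc _ ≤ ∫⁻ _, a ∂ν := lintegral_mono fun y => h y
    _ = a := by simp

theorem pi_eval_eq {α ι : Type*} [Fintype ι] [Finite α] [MeasurableSpace α]
    [DiscreteMeasurableSpace α] (μ : Measure α) [IsProbabilityMeasure μ] (j : ι) (y : α) :
    (Measure.pi fun _ : ι => μ) {x | x j = y} = μ {y} :=
  (measurePreserving_eval (fun _ : ι => μ) j).measure_preimage
    (Set.toFinite {y}).measurableSet.nullMeasurableSet

theorem pi_eval_eq_eval_le {α ι : Type*} [Fintype ι] [Finite α] [MeasurableSpace α]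
    [DiscreteMeasurableSpace α] (μ : Measure α) [IsProbabilityMeasure μ] {a : ℝ≥0∞}
    (h : ∀ y, μ {y} ≤ a) {j k : ι} (hjk : j ≠ k) :
    (Measure.pi fun _ : ι => μ) {x | x j = x k} ≤ a := by
  have hind : IndepFun (fun x : ι → α => x j) (fun x => x k) (Measure.pi fun _ : ι => μ) :=
    (iIndepFun_pi (μ := fun _ : ι => μ) (X := fun _ => id) fun _ => aemeasurable_id).indepFun hjk
  have hmap := (indepFun_iff_map_prod_eq_prod_map_map (measurable_pi_apply j).aemeasurable
    (measurable_pi_apply k).aemeasurable).1 hind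
  rw [(measurePreserving_eval (fun _ : ι => μ) j).map_eq,
    (measurePreserving_eval (fun _ : ι => μ) k).map_eq] at hmap
  refine le_trans (le_of_eq ?_) (prod_diagonal_le μ μ h)
  rw [← hmap, Measure.map_apply ((measurable_pi_apply j).prodMk (measurable_pi_apply k)) (Set.toFinite _).measurableSet]
  rfl

instance {d : ℕ} (e₁ e₂ : unitInterval) (S₁ : Finset (Fin d)) :
    IsProbabilityMeasure (backgroundLaw e₁ e₂ S₁) := by
  unfold backgroundLaw; infer_instance

/-- The law of the bit of a background point at the coordinate `i`. -/
noncomputable abbrev bitLaw {d : ℕ} (S₁ : Finset (Fin d)) (i : Fin d) : Measure Bool :=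
  bernoulliMeasure true false (if i ∈ S₁ then eps₁ else eps₂)

theorem bitLaw_real_le {d : ℕ} (S₁ : Finset (Fin d)) (i : Fin d) (c : Bool) :
    (bitLaw S₁ i).real {c} ≤ 7 / 10 := by
  rw [bernoulliMeasure_real_apply _ (MeasurableSet.singleton c)]
  by_cases hi : i ∈ S₁ <;> cases c <;> simp [hi, eps₁, eps₂] <;> norm_num

theorem bitLaw_real_of_notMem {d : ℕ} {S₁ : Finset (Fin d)} {i : Fin d} (hi : i ∉ S₁) (c : Bool) :
    (bitLaw S₁ i).real {c} = 1 / 2 := by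
  rw [bernoulliMeasure_real_apply _ (MeasurableSet.singleton c)]
  cases c <;> simp [hi, eps₂]
  norm_num

theorem backgroundLaw_singleton_le {d : ℕ} (S₁ : Finset (Fin d)) (y : Cube d) :
    backgroundLaw eps₁ eps₂ S₁ {y} ≤ ENNReal.ofReal ((7 / 10) ^ d) := by
  rw [backgroundLaw, Measure.pi_singleton, ENNReal.ofReal_pow (by norm_num)]
  calc _ ≤ ∏ _i : Fin d, ENNReal.ofReal (7 / 10) := by
        refine Finset.prod_le_prod' fun i _ => ?_
        rw [← ofReal_measureReal]
        exact ENNReal.ofReal_le_ofReal (bitLaw_real_le S₁ i (y i))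
    _ = _ := by simp

/-- The possible values of a planted point. -/
theorem choose_le_ncard_planted {d : ℕ} (t : ℕ) (S₁ : Finset (Fin d)) :
    S₁.card.choose t ≤
      {x : Cube d | hammingDist x (center d) = t ∧ ∀ i, x i = true → i ∈ S₁}.ncard := by
  classical
  rw [← Finset.card_powersetCard, ← Set.ncard_coe_finset]
  refine Set.ncard_le_ncard_of_injOn (fun U i => decide (i ∈ U)) (fun U hU => ?_)
    (fun U _ V _ h => ?_)
  · rw [Finset.mem_coe, Finset.mem_powersetCard] at hU
    refine ⟨?_, fun i hi => hU.1 (by simpa using hi)⟩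
    rw [← hU.2, hammingDist]
    congr 1
    ext i
    simp [center]
  · ext i
    simpa using congrFun h i

theorem plantedLaw_singleton_le {d : ℕ} (t : ℕ) (S₁ : Finset (Fin d)) (y : Cube d) :
    plantedLaw t S₁ {y} ≤ ((S₁.card.choose t : ℕ) : ℝ≥0∞)⁻¹ := by
  classical
  set s := {x : Cube d | hammingDist x (center d) = t ∧ ∀ i, x i = true → i ∈ S₁}
  have h := uniformOn_apply_finset (s := s.toFinset) (t := {y})
  rw [Set.coe_toFinset, Finset.coe_singleton] at h
  rw [plantedLaw, h]
  calc ((s.toFinset ∩ {y}).card : ℝ≥0∞) / s.toFinset.card ≤ 1 / (S₁.card.choose t : ℕ) := by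
        gcongr
        · exact_mod_cast (Finset.card_le_card Finset.inter_subset_right).trans (by simp)
        · rw [← Set.ncard_eq_toFinset_card']
          exact choose_le_ncard_planted t S₁
    _ = _ := one_div _

theorem isProbabilityMeasure_plantedLaw {d t : ℕ} {S₁ : Finset (Fin d)} (h : t ≤ S₁.card) :
    IsProbabilityMeasure (plantedLaw t S₁) := by
  refine isProbabilityMeasure_uniformOn (Set.toFinite _) ?_
  rw [← Set.ncard_pos]
  exact (Nat.choose_pos h).trans_le (choose_le_ncard_planted t S₁)

/-- A planted point differs from the center. -/
theorem plantedLaw_center {d t : ℕ} (ht : 0 < t) (S₁ : Finset (Fin d)) :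
    plantedLaw t S₁ {center d} = 0 := by
  rw [plantedLaw, uniformOn_eq_zero_iff (Set.toFinite _)]
  ext x
  simp only [Set.mem_inter_iff, Set.mem_ofPred_eq, Set.mem_singleton_iff, Set.mem_empty_iff_false,
    iff_false, not_and]
  rintro ⟨h, -⟩ rfl
  simp at h
  omega

/-! ### The data is distinct and balanced with high probability -/

/-- The data points are pairwise distinct, and within every subcube cut out by at most `K`
constraints that holds at least `d / 2` background points, the share of the background points with
the bit `c` at a free coordinate exceeds its expectation by at most `h`. -/
structure IsTypical {d N s : ℕ} (S₁ : Finset (Fin d)) (K : ℕ) (h : ℝ)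
    (ω : (Fin N → Cube d) × (Fin s → Cube d)) : Prop where
  injective_fst : ω.1.Injective
  injective_snd : ω.2.Injective
  fst_ne_center : ∀ j, ω.1 j ≠ center d
  snd_ne_center : ∀ k, ω.2 k ≠ center d
  fst_ne_snd : ∀ j k, ω.1 j ≠ ω.2 k
  count_le : ∀ T : Finset (Fin d × Bool), T.card ≤ K → ∀ i ∈ free T, ∀ c,
    (d / 2 : ℝ) ≤ count ω.1 T →
      (count ω.1 (insert (i, c) T) : ℝ) ≤ ((bitLaw S₁ i).real {c} + h) * count ω.1 T

theorem IsTypical.card_dataset {d N s K : ℕ} {S₁ : Finset (Fin d)} {h : ℝ}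
    {ω : (Fin N → Cube d) × (Fin s → Cube d)} (hω : IsTypical S₁ K h ω) :
    (dataset ω).card = N + (1 + s) := by
  have h1 : Disjoint (Finset.univ.image ω.1) (Finset.univ.image ω.2) := by
    rw [Finset.disjoint_left]
    simp only [Finset.mem_image, Finset.mem_univ, true_and]
    rintro _ ⟨j, rfl⟩ ⟨k, hk⟩
    exact hω.fst_ne_snd j k hk.symm
  rw [dataset, Finset.card_insert_of_notMem, Finset.card_union_of_disjoint h1,
    Finset.card_image_of_injective _ hω.injective_fst,
    Finset.card_image_of_injective _ hω.injective_snd]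
  · simp; omega
  · simp only [Finset.mem_union, Finset.mem_image, Finset.mem_univ, true_and, not_or, not_exists]
    exact ⟨hω.fst_ne_center, hω.snd_ne_center⟩

theorem card_subcube_le {d N s : ℕ} (ω : (Fin N → Cube d) × (Fin s → Cube d))
    (T : Finset (Fin d × Bool)) : (subcube (dataset ω) T).card ≤ count ω.1 T + (s + 1) := by
  have hsub : subcube (dataset ω) T ⊆
      (Finset.univ.filter fun j => ∀ e ∈ T, ω.1 j e.1 = e.2).image ω.1 ∪
        insert (center d) (Finset.univ.image ω.2) := by
    intro x hx
    simp only [subcube, dataset, Finset.mem_filter, Finset.mem_insert, Finset.mem_union,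
      Finset.mem_image, Finset.mem_univ, true_and] at hx ⊢
    obtain ⟨h | ⟨j, rfl⟩ | h, hT⟩ := hx
    · exact Or.inr (Or.inl h)
    · exact Or.inl ⟨j, hT, rfl⟩
    · exact Or.inr (Or.inr h)
  refine (Finset.card_le_card hsub).trans ((Finset.card_union_le _ _).trans ?_)
  refine add_le_add Finset.card_image_le ((Finset.card_insert_le _ _).trans ?_)
  exact Nat.succ_le_succ (Finset.card_image_le.trans (by simp))

theorem count_le_card_subcube {d N s : ℕ} {ω : (Fin N → Cube d) × (Fin s → Cube d)}
    (hω : ω.1.Injective) (T : Finset (Fin d × Bool)) :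
    count ω.1 T ≤ (subcube (dataset ω) T).card := by
  rw [count, ← Finset.card_image_of_injective _ hω]
  refine Finset.card_le_card fun x hx => ?_
  simp only [subcube, dataset, Finset.mem_filter, Finset.mem_insert, Finset.mem_union,
    Finset.mem_image, Finset.mem_univ, true_and] at hx ⊢
  obtain ⟨j, hT, rfl⟩ := hx
  exact ⟨Or.inr (Or.inl ⟨j, rfl⟩), hT⟩

/-- The center and the planted points are too few to unbalance a bucket of more than `d` points. -/
theorem IsTypical.isBalanced {d N s K : ℕ} {S₁ : Finset (Fin d)} {h : ℝ}
    {ω : (Fin N → Cube d) × (Fin s → Cube d)} (hω : IsTypical S₁ K h ω) (h0 : 0 ≤ h)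
    (h1 : h ≤ 1 / 20) (hs : (s + 1 : ℝ) ≤ h * d) : IsBalanced (dataset ω) S₁ K (2 * h) := by
  intro T hT hd i hi b
  rw [side_subcube]
  set n := (subcube (dataset ω) T).card
  have hdn : (d : ℝ) ≤ n := by exact_mod_cast hd.le
  have hd0 : (0 : ℝ) ≤ d := by positivity
  have hX : (n : ℝ) ≤ count ω.1 T + (s + 1) := by exact_mod_cast card_subcube_le ω T
  have hXn : (count ω.1 T : ℝ) ≤ n := by exact_mod_cast count_le_card_subcube hω.injective_fst T
  have hY : ((subcube (dataset ω) (insert (i, b) T)).card : ℝ) ≤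
      count ω.1 (insert (i, b) T) + (s + 1) := by exact_mod_cast card_subcube_le ω (insert (i, b) T)
  have hc := hω.count_le T hT i hi b (by nlinarith)
  have he0 : 0 ≤ (bitLaw S₁ i).real {b} := measureReal_nonneg
  have hmain : ((subcube (dataset ω) (insert (i, b) T)).card : ℝ) ≤
      ((bitLaw S₁ i).real {b} + 2 * h) * n := by
    have h2 : ((bitLaw S₁ i).real {b} + h) * count ω.1 T ≤ ((bitLaw S₁ i).real {b} + h) * n := by
      gcongr
    have h3 : h * d ≤ h * n := by gcongr
    linarith
  refine ⟨hmain.trans ?_, fun hiS => hmain.trans ?_⟩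
  · gcongr
    linarith [bitLaw_real_le S₁ i b]
  · rw [bitLaw_real_of_notMem hiS]

theorem measure_iUnion_le_card_mul {α ι : Type*} [Fintype ι] [MeasurableSpace α] (μ : Measure α)
    {s : ι → Set α} {a : ℝ≥0∞} (h : ∀ i, μ (s i) ≤ a) :
    μ (⋃ i, s i) ≤ Fintype.card ι * a := by
  refine (measure_iUnion_fintype_le μ s).trans ((Finset.sum_le_sum fun i _ => h i).trans ?_)
  simp

theorem card_finset_card_le {α : Type*} [Fintype α] [Nonempty α] (K : ℕ) :
    Fintype.card {T : Finset α // T.card ≤ K} ≤ (K + 1) * Fintype.card α ^ K := by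
  classical
  rw [Fintype.card_subtype]
  have hsub : (Finset.univ.filter fun T : Finset α => T.card ≤ K) ⊆
      (Finset.range (K + 1)).biUnion fun k => Finset.powersetCard k Finset.univ := by
    intro T hT
    simp only [Finset.mem_filter, Finset.mem_univ, true_and] at hT
    simp only [Finset.mem_biUnion, Finset.mem_range, Finset.mem_powersetCard, Finset.subset_univ,
      true_and]
    exact ⟨_, Nat.lt_succ_of_le hT, rfl⟩
  refine (Finset.card_le_card hsub).trans (Finset.card_biUnion_le.trans ?_)
  refine (Finset.sum_le_card_nsmul _ _ (Fintype.card α ^ K) fun k hk => ?_).trans (by simp)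
  rw [Finset.card_powersetCard, Finset.card_univ]
  exact (Nat.choose_le_pow _ _).trans
    (Nat.pow_le_pow_right Fintype.card_pos (Nat.le_of_lt_succ (Finset.mem_range.1 hk)))

/-- The union bound for the failure of `IsTypical`. -/
theorem dataLaw_not_isTypical_le {d N s t K : ℕ} {S₁ : Finset (Fin d)} (hd : 0 < d) (ht : 0 < t)
    (htS : t ≤ S₁.card) {h : ℝ} (h0 : 0 ≤ h) (h1 : h ≤ 1) :
    dataLaw eps₁ eps₂ S₁ t N s {ω | ¬ IsTypical S₁ K h ω} ≤
      ENNReal.ofReal ((N + (1 + s) : ℝ) ^ 2 * (7 / 10) ^ d + (s : ℝ) ^ 2 / S₁.card.choose t +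
        (K + 1) * (2 * d) ^ (K + 1) * Real.exp (-(h ^ 2 / 4 * (d / 2)))) := by
  classical
  have hpl := isProbabilityMeasure_plantedLaw htS
  have : Nonempty (Fin d) := ⟨⟨0, hd⟩⟩
  set μ := dataLaw eps₁ eps₂ S₁ t N s with hμ
  set a : ℝ := (7 / 10) ^ d
  set E : ℝ := Real.exp (-(h ^ 2 / 4 * (d / 2)))
  have hfst : ∀ A : (Fin N → Cube d) → Prop, μ {ω | A ω.1} =
      (Measure.pi fun _ => backgroundLaw eps₁ eps₂ S₁) {x | A x} := fun A =>
    measurePreserving_fst.measure_preimage (Set.toFinite {x | A x}).measurableSet.nullMeasurableSet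
  have hsnd : ∀ A : (Fin s → Cube d) → Prop, μ {ω | A ω.2} =
      (Measure.pi fun _ => plantedLaw t S₁) {x | A x} := fun A =>
    measurePreserving_snd.measure_preimage (Set.toFinite {x | A x}).measurableSet.nullMeasurableSet
  obtain ⟨B1, hB1⟩ : ∃ B : Set ((Fin N → Cube d) × (Fin s → Cube d)),
      B = ⋃ p : Fin N × Fin N, {ω | p.1 ≠ p.2 ∧ ω.1 p.1 = ω.1 p.2} := ⟨_, rfl⟩
  obtain ⟨B2, hB2⟩ : ∃ B : Set ((Fin N → Cube d) × (Fin s → Cube d)),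
      B = ⋃ j : Fin N, {ω | ω.1 j = center d} := ⟨_, rfl⟩
  obtain ⟨B3, hB3⟩ : ∃ B : Set ((Fin N → Cube d) × (Fin s → Cube d)),
      B = ⋃ p : Fin N × Fin s, {ω | ω.1 p.1 = ω.2 p.2} := ⟨_, rfl⟩
  obtain ⟨B4, hB4⟩ : ∃ B : Set ((Fin N → Cube d) × (Fin s → Cube d)),
      B = ⋃ p : Fin s × Fin s, {ω | p.1 ≠ p.2 ∧ ω.2 p.1 = ω.2 p.2} := ⟨_, rfl⟩
  obtain ⟨B5, hB5⟩ : ∃ B : Set ((Fin N → Cube d) × (Fin s → Cube d)),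
      B = ⋃ k : Fin s, {ω | ω.2 k = center d} := ⟨_, rfl⟩
  obtain ⟨B6, hB6⟩ : ∃ B : Set ((Fin N → Cube d) × (Fin s → Cube d)),
      B = ⋃ p : {T : Finset (Fin d × Bool) // T.card ≤ K} × (Fin d × Bool),
      {ω | p.2.1 ∈ free p.1.1 ∧ (d / 2 : ℝ) ≤ count ω.1 p.1.1 ∧
        ((bitLaw S₁ p.2.1).real {p.2.2} + h) * count ω.1 p.1.1 <
          count ω.1 (insert (p.2.1, p.2.2) p.1.1)} := ⟨_, rfl⟩
  have b1 : μ B1 ≤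
      Fintype.card (Fin N × Fin N) * ENNReal.ofReal a := by
    rw [hB1]
    refine measure_iUnion_le_card_mul μ fun p => ?_
    by_cases hp : p.1 = p.2
    · simp [hp]
    exact (measure_mono fun ω hω => hω.2).trans ((hfst fun x => x p.1 = x p.2).trans_le
      (pi_eval_eq_eval_le _ (backgroundLaw_singleton_le S₁) hp))
  have b2 : μ B2 ≤
      Fintype.card (Fin N) * ENNReal.ofReal a := by
    rw [hB2]
    refine measure_iUnion_le_card_mul μ fun j => ?_
    rw [hfst fun x => x j = center d, pi_eval_eq]
    exact backgroundLaw_singleton_le S₁ _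
  have b3 : μ B3 ≤
      Fintype.card (Fin N × Fin s) * ENNReal.ofReal a := by
    rw [hB3]
    refine measure_iUnion_le_card_mul μ fun p => ?_
    rw [hμ, dataLaw, Measure.prod_apply_symm (Set.toFinite _).measurableSet]
    calc _ ≤ ∫⁻ _, ENNReal.ofReal a ∂(Measure.pi fun _ : Fin s => plantedLaw t S₁) := by
          refine lintegral_mono fun y => ?_
          refine le_trans (le_of_eq ?_) (backgroundLaw_singleton_le S₁ (y p.2))
          exact pi_eval_eq (backgroundLaw eps₁ eps₂ S₁) p.1 (y p.2)
      _ = _ := by simp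
  have b4 : μ B4 ≤
      Fintype.card (Fin s × Fin s) * ((S₁.card.choose t : ℕ) : ℝ≥0∞)⁻¹ := by
    rw [hB4]
    refine measure_iUnion_le_card_mul μ fun p => ?_
    by_cases hp : p.1 = p.2
    · simp [hp]
    exact (measure_mono fun ω hω => hω.2).trans ((hsnd fun x => x p.1 = x p.2).trans_le
      (pi_eval_eq_eval_le _ (plantedLaw_singleton_le t S₁) hp))
  have b5 : μ B5 ≤ Fintype.card (Fin s) * 0 := by
    rw [hB5]
    refine measure_iUnion_le_card_mul μ fun k => ?_
    rw [hsnd fun x => x k = center d, pi_eval_eq, plantedLaw_center ht]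
  have b6 : μ B6 ≤
      Fintype.card ({T : Finset (Fin d × Bool) // T.card ≤ K} × (Fin d × Bool)) *
        ENNReal.ofReal E := by
    rw [hB6]
    refine measure_iUnion_le_card_mul μ fun p => ?_
    by_cases hp : p.2.1 ∈ free p.1.1
    · exact (measure_mono fun ω hω => hω.2).trans
        ((hfst fun x => (d / 2 : ℝ) ≤ count x p.1.1 ∧
          ((bitLaw S₁ p.2.1).real {p.2.2} + h) * count x p.1.1 <
            count x (insert (p.2.1, p.2.2) p.1.1)).trans_le
        (measure_count_le (bitLaw S₁) hp p.2.2 h0 h1))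
    · simp [hp]
  have hcover : {ω | ¬ IsTypical S₁ K h ω} ⊆ B1 ∪ B2 ∪ B3 ∪ B4 ∪ B5 ∪ B6 := fun ω hω => by
    by_contra hnot
    refine hω ?_
    simp only [Set.mem_union, not_or] at hnot
    obtain ⟨⟨⟨⟨⟨n1, n2⟩, n3⟩, n4⟩, n5⟩, n6⟩ := hnot
    rw [hB1, Set.mem_iUnion, not_exists] at n1
    rw [hB2, Set.mem_iUnion, not_exists] at n2
    rw [hB3, Set.mem_iUnion, not_exists] at n3
    rw [hB4, Set.mem_iUnion, not_exists] at n4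
    rw [hB5, Set.mem_iUnion, not_exists] at n5
    rw [hB6, Set.mem_iUnion, not_exists] at n6
    refine ⟨fun j k hjk => ?_, fun j k hjk => ?_, n2, n5, fun j k => n3 (j, k),
      fun T hT i hi c hX => ?_⟩
    · by_contra hne
      exact n1 (j, k) ⟨hne, hjk⟩
    · by_contra hne
      exact n4 (j, k) ⟨hne, hjk⟩
    · by_contra hY
      exact n6 (⟨T, hT⟩, i, c) ⟨hi, hX, not_le.1 hY⟩
  have hcardT : (Fintype.card ({T : Finset (Fin d × Bool) // T.card ≤ K} × (Fin d × Bool)) : ℝ) ≤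
      (K + 1) * (2 * d) ^ (K + 1) := by
    have h2 := card_finset_card_le (α := Fin d × Bool) K
    rw [Fintype.card_prod]
    have h3 : Fintype.card (Fin d × Bool) = 2 * d := by simp [mul_comm]
    rw [h3] at h2 ⊢
    have h4 : Fintype.card {T : Finset (Fin d × Bool) // T.card ≤ K} * (2 * d) ≤
        (K + 1) * (2 * d) ^ (K + 1) := by
      exact (Nat.mul_le_mul_right (2 * d) h2).trans_eq (by ring)
    exact_mod_cast h4
  have hC : (0 : ℝ) < S₁.card.choose t := by exact_mod_cast Nat.choose_pos htS
  refine (measure_mono hcover).trans ((measure_union_le _ _).trans (add_le_add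
    ((measure_union_le _ _).trans (add_le_add ((measure_union_le _ _).trans (add_le_add
    ((measure_union_le _ _).trans (add_le_add ((measure_union_le _ _).trans
    (add_le_add b1 b2)) b3)) b4)) b5)) b6) |>.trans ?_)
  have ha : 0 ≤ a := by positivity
  have hE : 0 ≤ E := (Real.exp_pos _).le
  rw [mul_zero, add_zero, ← ENNReal.ofReal_natCast (S₁.card.choose t),
    ← ENNReal.ofReal_inv_of_pos hC]
  simp only [← ENNReal.ofReal_natCast (Fintype.card _)]
  repeat rw [← ENNReal.ofReal_mul (Nat.cast_nonneg _)]
  repeat rw [← ENNReal.ofReal_add (by positivity) (by positivity)]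
  refine ENNReal.ofReal_le_ofReal ?_
  refine add_le_add (add_le_add ?_ ?_) (mul_le_mul_of_nonneg_right hcardT hE)
  · rw [← add_mul, ← add_mul]
    refine mul_le_mul_of_nonneg_right ?_ ha
    simp only [Fintype.card_prod, Fintype.card_fin, Nat.cast_mul]
    nlinarith [Nat.cast_nonneg (α := ℝ) N, Nat.cast_nonneg (α := ℝ) s,
      mul_nonneg (Nat.cast_nonneg (α := ℝ) N) (Nat.cast_nonneg (α := ℝ) s)]
  · simp only [Fintype.card_prod, Fintype.card_fin, Nat.cast_mul]
    rw [div_eq_mul_inv, pow_two]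

/-! ### Size of the parameters -/

/-- The dimension is large enough for the estimates that do not involve `m`: `√(ln d)` exceeds the
constants in them, and `d` exceeds the powers of `ln d`. -/
structure IsLarge (d : ℕ) : Prop where
  sqrt_log : 1000 ≤ √(Real.log d)
  log_pow : 10 ^ 6 * Real.log d ^ 4 ≤ d

theorem eventually_isLarge : ∀ᶠ d : ℕ in atTop, IsLarge d := by
  have h1 : ∀ᶠ d : ℕ in atTop, (1000 : ℝ) ≤ √(Real.log d) :=
    (Real.tendsto_sqrt_atTop.comp
      (Real.tendsto_log_atTop.comp tendsto_natCast_atTop_atTop)).eventually_ge_atTop _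
  have h2 : ∀ᶠ d : ℕ in atTop, (10 ^ 6 : ℝ) * Real.log d ^ 4 ≤ d := by
    have h := ((Real.isLittleO_pow_log_id_atTop (n := 4)).def
      (c := (10 ^ 6)⁻¹) (by norm_num)).natCast_atTop
    filter_upwards [h] with d hd
    rw [Real.norm_of_nonneg (by positivity), id, Real.norm_of_nonneg (by positivity)] at hd
    rw [inv_mul_eq_div, le_div_iff₀ (by norm_num)] at hd
    linarith
  filter_upwards [h1, h2] with d h1 h2 using ⟨h1, h2⟩

theorem exp_neg_le {y : ℝ} (hy : 1000 ≤ y) : Real.exp (-y) ≤ 3 / 1000 := by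
  have h1 := Real.add_one_le_exp y
  rw [Real.exp_neg, inv_le_comm₀ (Real.exp_pos _) (by norm_num)]
  norm_num
  linarith

theorem two_pow_le_choose {M t : ℕ} (ht : 0 < t) (h : 2 * t ≤ M) : 2 ^ t ≤ M.choose t := by
  have h1 := Nat.four_pow_le_two_mul_self_mul_centralBinom t ht
  have h2 : 2 * t ≤ 2 ^ t := by
    obtain ⟨t, rfl⟩ := Nat.exists_eq_succ_of_ne_zero ht.ne'
    have := Nat.lt_two_pow_self (n := t)
    rw [pow_succ]; omega
  have h3 : 2 ^ t * 2 ^ t ≤ 2 ^ t * t.centralBinom := by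
    rw [← mul_pow]; exact h1.trans (Nat.mul_le_mul_right _ h2)
  exact (Nat.le_of_mul_le_mul_left h3 (by positivity)).trans (Nat.choose_le_choose t h)

theorem lt_radius_add_one (d : ℕ) : (d : ℝ) / √(Real.log d) < radius d + 1 :=
  Nat.lt_floor_add_one _

namespace IsLarge

variable {d : ℕ}

theorem log_ge (h : IsLarge d) : 10 ^ 6 ≤ Real.log d := by
  have := Real.le_sqrt' (by norm_num : (0 : ℝ) < 1000) |>.1 h.sqrt_log
  linarith

theorem sq_sqrt (h : IsLarge d) : √(Real.log d) ^ 2 = Real.log d :=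
  Real.sq_sqrt (by linarith [h.log_ge])

theorem log_le (h : IsLarge d) : 10 ^ 6 * Real.log d ≤ d := by
  refine le_trans ?_ h.log_pow
  have := h.log_ge
  gcongr
  exact le_self_pow₀ (by linarith) (by norm_num)

theorem cast_ge (h : IsLarge d) : 10 ^ 12 ≤ (d : ℝ) := by
  linarith [h.log_le, h.log_ge]

theorem pos (h : IsLarge d) : (0 : ℝ) < d := by linarith [h.cast_ge]

theorem nat_pos (h : IsLarge d) : 0 < d := by exact_mod_cast h.pos

theorem sqrt_le_log (h : IsLarge d) : √(Real.log d) ≤ Real.log d := by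
  nlinarith [h.sqrt_log, h.sq_sqrt]

theorem radius_le (h : IsLarge d) : (radius d : ℝ) / d ≤ 1 / √(Real.log d) := by
  have h1 : (radius d : ℝ) ≤ d / √(Real.log d) := Nat.floor_le (by positivity)
  rw [div_le_iff₀ h.pos]
  linarith [mul_comm_div (1 : ℝ) √(Real.log d) d, one_mul ((d : ℝ) / √(Real.log d))]

theorem radius_add_one_le (h : IsLarge d) : ((radius d : ℝ) + 1) / d ≤ 2 / √(Real.log d) := by
  have h1 := h.radius_le
  have h2 : 1 / (d : ℝ) ≤ 1 / √(Real.log d) :=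
    one_div_le_one_div_of_le (by linarith [h.sqrt_log])
      (by linarith [h.sqrt_le_log, h.log_le, h.log_ge])
  rw [add_div]
  calc _ ≤ 1 / √(Real.log d) + 1 / √(Real.log d) := add_le_add h1 h2
    _ = _ := by ring

theorem radius_add_one_div_le (h : IsLarge d) : ((radius d : ℝ) + 1) / d ≤ 1 / 4 := by
  refine h.radius_add_one_le.trans ?_
  rw [div_le_div_iff₀ (by linarith [h.sqrt_log]) (by norm_num)]
  linarith [h.sqrt_log]

theorem four_mul_radius_le (h : IsLarge d) : 4 * (radius d + 1) ≤ d := by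
  have := h.radius_add_one_div_le
  rw [div_le_iff₀ h.pos] at this
  have h2 : 4 * ((radius d : ℝ) + 1) ≤ d := by linarith
  exact_mod_cast h2

theorem inv_sqrt_log_le (h : IsLarge d) : 1 / √(Real.log d) ≤ 1 / 1000 :=
  one_div_le_one_div_of_le (by norm_num) h.sqrt_log

theorem ceil_le (h : IsLarge d) : (⌈25 * Real.log d⌉₊ : ℝ) ≤ 26 * Real.log d := by
  have := (Nat.ceil_lt_add_one (by linarith [h.log_ge] : 0 ≤ 25 * Real.log d)).le
  linarith [h.log_ge]

/-- The number of levels suffices to pass from `n` points to `d` points. -/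
theorem numPoints_le (h : IsLarge d) :
    (numPoints d : ℝ) ≤ d * (5 / 4) ^ ⌈25 * Real.log d⌉₊ := by
  have h1 : (1 : ℝ) / 5 ≤ Real.log (5 / 4) := by
    have := Real.one_sub_inv_le_log_of_pos (by norm_num : (0 : ℝ) < 5 / 4)
    norm_num at this ⊢
    linarith
  have h2 : 25 * Real.log d ≤ ⌈25 * Real.log d⌉₊ := Nat.le_ceil _
  have h3 : (d : ℝ) ^ 5 ≤ (5 / 4) ^ ⌈25 * Real.log d⌉₊ := by
    rw [← Real.log_le_log_iff (pow_pos h.pos 5) (by positivity), Real.log_pow, Real.log_pow]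
    have := h.log_ge
    push_cast
    nlinarith
  calc (numPoints d : ℝ) = d * (d : ℝ) ^ 5 := by simp only [numPoints]; push_cast; ring
    _ ≤ _ := by gcongr

theorem numPlanted_add_one_le (h : IsLarge d) :
    (numPlanted d + 1 : ℝ) ≤ 1 / (2 * √(Real.log d)) * d := by
  have hs : (numPlanted d : ℝ) ≤ √d := Real.nat_sqrt_le_real_sqrt
  have hd := Real.sq_sqrt h.pos.le
  have h1 : 1 ≤ √(d : ℝ) := Real.one_le_sqrt.2 (by linarith [h.cast_ge])
  have hx := h.sqrt_log
  have h4 : 4 * √(Real.log d) ≤ √(d : ℝ) := by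
    refine Real.le_sqrt_of_sq_le ?_
    rw [mul_pow, h.sq_sqrt]
    linarith [h.log_le, h.log_ge]
  rw [div_mul_eq_mul_div, one_mul, le_div_iff₀ (by positivity)]
  nlinarith

theorem numBackground_add (h : IsLarge d) :
    numBackground d + (1 + numPlanted d) = numPoints d := by
  refine Nat.sub_add_cancel ?_
  have h1 : 2 ≤ d := by
    have : (2 : ℝ) ≤ d := by linarith [h.cast_ge]
    exact_mod_cast this
  calc 1 + numPlanted d ≤ d + d := add_le_add h.nat_pos (Nat.sqrt_le_self d)
    _ = d * 2 := by ring
    _ ≤ d * d ^ 5 := Nat.mul_le_mul_left _ (h1.trans (Nat.le_self_pow (by norm_num) d))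
    _ = numPoints d := by rw [numPoints]; ring

theorem collision_background_le (h : IsLarge d) :
    ((numPoints d : ℝ)) ^ 2 * (7 / 10) ^ d ≤ 3 / 1000 := by
  have h1 : (7 / 10 : ℝ) ≤ Real.exp (-(3 / 10)) := by
    have := Real.add_one_le_exp (-(3 / 10) : ℝ)
    linarith
  have h2 : (d : ℝ) = Real.exp (Real.log d) := (Real.exp_log h.pos).symm
  calc ((numPoints d : ℝ)) ^ 2 * (7 / 10) ^ d
      ≤ (Real.exp (Real.log d)) ^ 12 * Real.exp (-(3 / 10)) ^ d := by
        rw [← h2, numPoints]; push_cast; rw [← pow_mul]; gcongr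
    _ = Real.exp (-(3 / 10 * d - 12 * Real.log d)) := by
        rw [← Real.exp_nat_mul, ← Real.exp_nat_mul, ← Real.exp_add]; congr 1; push_cast; ring
    _ ≤ _ := exp_neg_le (by linarith [h.log_le, h.log_ge])

theorem log_mul_le_div_sqrt (h : IsLarge d) :
    10 ^ 6 * Real.log d ≤ d / √(Real.log d) := by
  have hL := h.log_ge
  rw [le_div_iff₀ (by linarith [h.sqrt_log])]
  refine le_trans ?_ h.log_pow
  have : Real.log d * √(Real.log d) ≤ Real.log d ^ 4 := by
    calc Real.log d * √(Real.log d) ≤ Real.log d * Real.log d := by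
          gcongr; exact h.sqrt_le_log
      _ = Real.log d ^ 2 := by ring
      _ ≤ _ := pow_le_pow_right₀ (by linarith) (by norm_num)
  linarith

theorem collision_planted_le (h : IsLarge d) {M : ℕ} (hM : 2 * M = d) :
    (numPlanted d : ℝ) ^ 2 / M.choose (radius d + 1) ≤ 3 / 1000 := by
  have h4 := h.four_mul_radius_le
  have hC : (2 : ℝ) ^ (radius d + 1) ≤ M.choose (radius d + 1) := by
    exact_mod_cast two_pow_le_choose (Nat.succ_pos _) (by omega : 2 * (radius d + 1) ≤ M)
  have hs : (numPlanted d : ℝ) ^ 2 ≤ d := by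
    exact_mod_cast Nat.sqrt_le' d
  have h2 : Real.exp (1 / 2) ≤ 2 := by
    rw [← Real.le_log_iff_exp_le (by norm_num)]
    linarith [Real.log_two_gt_d9]
  have hr := lt_radius_add_one d
  have hx := h.log_mul_le_div_sqrt
  calc (numPlanted d : ℝ) ^ 2 / M.choose (radius d + 1)
      ≤ Real.exp (Real.log d) / Real.exp (1 / 2) ^ (radius d + 1) := by
        rw [Real.exp_log h.pos]
        gcongr
        exact (pow_le_pow_left₀ (Real.exp_pos _).le h2 _).trans hC
    _ = Real.exp (-(1 / 2 * (radius d + 1) - Real.log d)) := by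
        rw [← Real.exp_nat_mul, ← Real.exp_sub]; congr 1; push_cast; ring
    _ ≤ _ := exp_neg_le (by linarith [h.log_ge])

theorem unbalanced_le (h : IsLarge d) :
    ((⌈25 * Real.log d⌉₊ : ℕ) + 1 : ℝ) * (2 * d) ^ (⌈25 * Real.log d⌉₊ + 1) *
      Real.exp (-((1 / (2 * √(Real.log d))) ^ 2 / 4 * (d / 2))) ≤ 3 / 1000 := by
  have hL := h.log_ge
  set K := ⌈25 * Real.log d⌉₊
  have hK : (K : ℝ) ≤ 26 * Real.log d := h.ceil_le
  have h1 : (K : ℝ) + 1 ≤ Real.exp K := Real.add_one_le_exp _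
  have h2 : 2 * (d : ℝ) ≤ Real.exp (2 * Real.log d) := by
    rw [two_mul (Real.log d), Real.exp_add, Real.exp_log h.pos]
    gcongr
    linarith [h.cast_ge]
  have h3 : (1 / (2 * √(Real.log d))) ^ 2 / 4 * ((d : ℝ) / 2) = d / (32 * Real.log d) := by
    rw [div_pow, mul_pow, h.sq_sqrt]
    field_simp
    ring
  have h4 : 30000 * Real.log d ^ 3 ≤ d / (32 * Real.log d) := by
    rw [le_div_iff₀ (by positivity)]
    have := h.log_pow
    nlinarith [pow_nonneg (show 0 ≤ Real.log d by linarith) 4]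
  have h5 : Real.log d ^ 2 ≤ Real.log d ^ 3 := pow_le_pow_right₀ (by linarith) (by norm_num)
  have h6 : Real.log d ≤ Real.log d ^ 2 := le_self_pow₀ (by linarith) (by norm_num)
  calc _ ≤ Real.exp K * Real.exp (2 * Real.log d) ^ (K + 1) *
        Real.exp (-(d / (32 * Real.log d))) := by rw [h3]; gcongr
    _ = Real.exp (-(d / (32 * Real.log d) - K - (K + 1) * (2 * Real.log d))) := by
        rw [← Real.exp_nat_mul, ← Real.exp_add, ← Real.exp_add]; congr 1; push_cast; ring
    _ ≤ _ := exp_neg_le (by nlinarith)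

end IsLarge

/-! ### Comparison with uniform LSH -/

/-- A first-order lower bound for a quotient of logarithms. -/
theorem div_le_log_div_log {u v : ℝ} (hu0 : 0 ≤ u) (hu : u < 1) (hv0 : 0 < v) (hv : v < 1) :
    u * (1 - v) / v ≤ Real.log (1 - u) / Real.log (1 - v) := by
  have h1 : Real.log (1 - u) ≤ -u := by
    linarith [Real.log_le_sub_one_of_pos (sub_pos.2 hu)]
  have h2 : 1 - (1 - v)⁻¹ ≤ Real.log (1 - v) := Real.one_sub_inv_le_log_of_pos (sub_pos.2 hv)
  have h3 : Real.log (1 - v) < 0 := Real.log_neg (by linarith) (by linarith)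
  have h4 : -(v / (1 - v)) ≤ Real.log (1 - v) := by
    convert h2 using 1
    have : 1 - v ≠ 0 := by linarith
    field_simp
    ring
  rw [← neg_div_neg_eq (Real.log (1 - u)), div_le_div_iff₀ hv0 (by linarith)]
  have h5 : (1 - v) * -Real.log (1 - v) ≤ v := by
    have := mul_le_mul_of_nonneg_left (neg_le.1 h4) (sub_pos.2 hv).le
    rwa [mul_div_cancel₀ _ (by linarith : 1 - v ≠ 0)] at this
  calc u * (1 - v) * -Real.log (1 - v) = u * ((1 - v) * -Real.log (1 - v)) := by ring
    _ ≤ u * v := by gcongr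
    _ ≤ _ := by gcongr; linarith

theorem uniformSuccess_le {d k : ℕ} (hd : 0 < d) {q p : Cube d} :
    uniformSuccess k q p ≤ ENNReal.ofReal ((1 - hammingDist q p / d) ^ k) := by
  classical
  have hd' : (0 : ℝ) < d := by exact_mod_cast hd
  have hset : {h : Fin k → Fin d | ∀ j, q (h j) = p (h j)} =
      (Fintype.piFinset fun _ : Fin k => Finset.univ.filter fun i => q i = p i : Finset _) := by
    ext h; simp
  have hcard : ((Finset.univ.filter fun i => q i = p i).card : ℝ) = d - hammingDist q p := by
    have := Finset.card_filter_add_card_filter_not (s := (Finset.univ : Finset (Fin d)))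
      (fun i => q i = p i)
    rw [Finset.card_univ, Fintype.card_fin] at this
    rw [eq_sub_iff_add_eq]
    exact_mod_cast this
  rw [uniformSuccess, uniformOn_univ, hset, Measure.count_apply_finset, Fintype.card_piFinset_const,
    Fintype.card_fun, Fintype.card_fin, Fintype.card_fin, one_sub_div hd'.ne', ← hcard, div_pow,
    ENNReal.ofReal_div_of_pos (by positivity)]
  apply le_of_eq
  congr 1 <;> · rw [← ENNReal.ofReal_natCast]; push_cast; rfl

/-- Uniform LSH on a query at distance exactly `r` from the center. -/
theorem minSuccess_uniformSuccess_le {d k r : ℕ} {P : Finset (Cube d)} (hP : center d ∈ P)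
    (hd : 0 < d) (hr : r ≤ d) :
    minSuccess P r (uniformSuccess k) ≤ ENNReal.ofReal ((1 - r / d) ^ k) := by
  classical
  obtain ⟨U, -, hU⟩ := Finset.exists_subset_card_eq (s := (Finset.univ : Finset (Fin d)))
    (n := r) (by simpa using hr)
  set q : Cube d := fun i => decide (i ∈ U)
  have hq : hammingDist q (center d) = r := by
    rw [← hU, hammingDist]
    congr 1
    ext i
    simp [center, q]
  calc minSuccess P r (uniformSuccess k) ≤ uniformSuccess k q (center d) :=
        iInf_le_of_le (center d) (iInf_le_of_le hP (iInf_le_of_le q (iInf_le_of_le hq.le le_rfl)))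
    _ ≤ _ := hq ▸ uniformSuccess_le hd

theorem kU_eq {d : ℕ} (hd : 0 < d) : kU d = 5 * Real.log d / Real.log (10 / 3) := by
  have hd' : (d : ℝ) ≠ 0 := by exact_mod_cast hd.ne'
  have h1 : (numPoints d : ℝ) / d = (d : ℝ) ^ 5 := by
    rw [numPoints]; push_cast; field_simp
  have h2 : (1 : ℝ) / (eps₁ : ℝ) = 10 / 3 := by
    simp only [eps₁]; norm_num
  rw [kU, h1, h2, Real.log_pow]
  norm_num

namespace IsLarge

variable {d m : ℕ}

theorem kU_le (h : IsLarge d) : kU d ≤ 8 * Real.log d := by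
  have h1 := Real.one_sub_inv_le_log_of_pos (by norm_num : (0 : ℝ) < 10 / 3)
  norm_num at h1
  rw [kU_eq h.nat_pos, div_le_iff₀ (by linarith)]
  nlinarith [h.log_ge]

theorem le_kU (h : IsLarge d) : 2 * Real.log d ≤ kU d := by
  have h1 := Real.log_le_sub_one_of_pos (by norm_num : (0 : ℝ) < 10 / 3)
  have h2 := Real.log_pos (by norm_num : (1 : ℝ) < 10 / 3)
  rw [kU_eq h.nat_pos, le_div_iff₀ h2]
  nlinarith [h.log_ge]

theorem one_sub_pos (h : IsLarge d) : 0 < 1 - 1 / √(Real.log d) := by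
  linarith [h.inv_sqrt_log_le]

theorem le_factor (h : IsLarge d) :
    (d : ℝ) ^ (-epsBar m d) * Real.exp √(Real.log d) ≤ factor m d := by
  have hx : 0 < √(Real.log d) := by linarith [h.sqrt_log]
  rw [factor]
  refine mul_le_mul_of_nonneg_left ?_ (Real.rpow_nonneg h.pos.le _)
  rw [Real.rpow_def_of_pos h.one_sub_pos, Real.exp_le_exp]
  have h1 : Real.log (1 - 1 / √(Real.log d)) ≤ -(1 / √(Real.log d)) := by
    linarith [Real.log_le_sub_one_of_pos h.one_sub_pos]
  have h2 := h.le_kU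
  calc √(Real.log d) = 1 / √(Real.log d) * Real.log d := by
        nth_rewrite 3 [← h.sq_sqrt]; field_simp
    _ ≤ 1 / √(Real.log d) * kU d := by gcongr; linarith [h.log_ge]
    _ ≤ _ := by nlinarith [h.log_ge]

theorem factor_le (h : IsLarge d) :
    factor m d ≤ (d : ℝ) ^ (-epsBar m d) * Real.exp (16 * √(Real.log d)) := by
  have hx : 0 < √(Real.log d) := by linarith [h.sqrt_log]
  rw [factor]
  refine mul_le_mul_of_nonneg_left ?_ (Real.rpow_nonneg h.pos.le _)
  rw [Real.rpow_def_of_pos h.one_sub_pos, Real.exp_le_exp]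
  have h1 : -(2 / √(Real.log d)) ≤ Real.log (1 - 1 / √(Real.log d)) := by
    refine le_trans ?_ (Real.one_sub_inv_le_log_of_pos h.one_sub_pos)
    rw [neg_le_sub_iff_le_add, inv_le_iff_one_le_mul₀ h.one_sub_pos]
    have h3 : 2 / √(Real.log d) = 2 * (1 / √(Real.log d)) := by ring
    have h4 : 0 < 1 / √(Real.log d) := by positivity
    rw [h3]
    nlinarith [h.inv_sqrt_log_le]
  have h2 := h.kU_le
  have h0 : 0 ≤ kU d := by linarith [h.le_kU, h.log_ge]
  calc _ ≤ 2 / √(Real.log d) * kU d := by nlinarith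
    _ ≤ 2 / √(Real.log d) * (8 * Real.log d) := by gcongr
    _ = _ := by nth_rewrite 2 [← h.sq_sqrt]; field_simp; norm_num

theorem factor_nonneg (h : IsLarge d) : 0 ≤ factor m d :=
  mul_nonneg (Real.rpow_nonneg h.pos.le _) (Real.rpow_nonneg h.one_sub_pos.le _)

theorem radius_div_le (h : IsLarge d) : (radius d : ℝ) / d ≤ 1 / 2 := by
  linarith [h.radius_le, h.inv_sqrt_log_le]

theorem rhoUniform_nonneg (h : IsLarge d) : 0 ≤ rhoUniform d := by
  have h1 := h.radius_div_le
  have h2 := h.radius_add_one_div_le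
  have h3 : 0 ≤ (radius d : ℝ) / d := by positivity
  have h4 : 0 ≤ ((radius d : ℝ) + 1) / d := by positivity
  exact div_nonneg_of_nonpos (Real.log_nonpos (by linarith) (by linarith))
    (Real.log_nonpos (by linarith) (by linarith))

/-- For fixed `m`, the exponent of the optimized tree on `d` points is bounded away from `1`: it
tends to `m / (m - 1)`. -/
theorem le_rhoOptimized (h : IsLarge d) (hm : 1 < m) (hmd : 834 * m ≤ √(Real.log d)) :
    1 + 1 / (2 * m) ≤ rhoOptimized m d := by
  have hd := h.pos
  have hx := h.sqrt_log
  have hm' : (2 : ℝ) ≤ m := by exact_mod_cast hm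
  set x := √(Real.log d) with hxdef
  set w := ((radius d : ℝ) + 1) / d with hw
  have hwx : w ≤ 2 / x := h.radius_add_one_le
  have hw4 : w ≤ 1 / 4 := h.radius_add_one_div_le
  have hw0 : 0 < w := by positivity
  have hf0 : (0 : ℝ) < 1 - 1 / m := by
    rw [sub_pos, div_lt_one (by linarith)]; linarith
  have hf1 : (1 : ℝ) - 1 / m ≤ 1 := by
    have : (0 : ℝ) ≤ 1 / m := by positivity
    linarith
  have hv1 : (1 - 1 / (m : ℝ)) * w ≤ w := mul_le_of_le_one_left hw0.le hf1
  have hv0 : 0 < (1 - 1 / (m : ℝ)) * w := by positivity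
  refine le_trans ?_ (div_le_log_div_log (u := (radius d : ℝ) / d) (by positivity)
    (by linarith [h.radius_div_le])
    hv0 (by linarith))
  have hu : (radius d : ℝ) / d = w - 1 / d := by rw [hw]; ring
  have hxw : 1 / x ≤ w := by
    rw [hw, div_le_div_iff₀ (by linarith) hd]
    have := lt_radius_add_one d
    rw [div_lt_iff₀ (by linarith)] at this
    linarith
  -- `1 / d ≤ (1 / x) ^ 2 ≤ w / x`
  have hdx : 1 / (d : ℝ) ≤ w * (1 / x) := by
    have h1 : 1 / (d : ℝ) ≤ 1 / x * (1 / x) := by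
      rw [one_div_mul_one_div, ← pow_two, h.sq_sqrt]
      exact one_div_le_one_div_of_le (by linarith [h.log_ge]) (by linarith [h.log_le, h.log_ge])
    exact h1.trans (by gcongr)
  have hx0 : 0 < 1 / x := by positivity
  have h3x : 3 * (1 / x) * (2 * (m + 1)) ≤ 1 := by
    rw [mul_one_div, div_mul_eq_mul_div, div_le_one (by linarith)]
    linarith
  have hkey : w * (1 - 3 * (1 / x)) ≤
      (radius d : ℝ) / d * (1 - (1 - 1 / (m : ℝ)) * w) := by
    have h1 : w * (1 - 1 / x) ≤ (radius d : ℝ) / d := by rw [hu]; linarith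
    have h2 : 1 - 2 * (1 / x) ≤ 1 - (1 - 1 / (m : ℝ)) * w := by
      have : 2 / x = 2 * (1 / x) := by ring
      linarith
    have h3 : 1 / x ≤ 1 / 1000 := h.inv_sqrt_log_le
    calc w * (1 - 3 * (1 / x)) ≤ w * (1 - 1 / x) * (1 - 2 * (1 / x)) := by
          nlinarith [mul_pos hw0 (mul_pos hx0 hx0)]
      _ ≤ _ := mul_le_mul h1 h2 (by linarith) (by positivity)
  rw [le_div_iff₀ hv0]
  refine le_trans ?_ hkey
  have h5 : (1 + 1 / (2 * (m : ℝ))) * (1 - 1 / m) ≤ 1 - 3 * (1 / x) := by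
    have h6 : 3 * (1 / x) ≤ 1 / (2 * (m + 1)) := by
      rw [le_div_iff₀ (by positivity)]; exact h3x
    have h7 : (1 + 1 / (2 * (m : ℝ))) * (1 - 1 / m) ≤ 1 - 1 / (2 * (m + 1)) := by
      have e1 : (1 + 1 / (2 * (m : ℝ))) * (1 - 1 / m) = 1 - 1 / (2 * m) - 1 / (2 * m) * (1 / m) := by
        field_simp; ring
      have e2 : 1 / (2 * ((m : ℝ) + 1)) ≤ 1 / (2 * m) :=
        one_div_le_one_div_of_le (by positivity) (by linarith)
      have e3 : 0 ≤ 1 / (2 * (m : ℝ)) * (1 / m) := by positivity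
      linarith
    linarith
  calc _ = w * ((1 + 1 / (2 * (m : ℝ))) * (1 - 1 / m)) := by ring
    _ ≤ _ := by gcongr

/-- The loss in the passage from `n` to `d` points is dominated by the gain from
`rhoOptimized m d > 1` in the passage from `d` points to one. -/
theorem rpow_neg_rhoOptimized_le (h : IsLarge d) (hm : 1 < m) (hmd : 834 * m ≤ √(Real.log d)) :
    (d : ℝ) ^ (-rhoOptimized m d) * Real.exp (17 * √(Real.log d)) ≤
      Real.exp (-(400 * √(Real.log d))) / d := by
  have hm' : (2 : ℝ) ≤ m := by exact_mod_cast hm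
  have hrho := h.le_rhoOptimized hm hmd
  have h1 : Real.exp (-(400 * √(Real.log d))) / d =
      Real.exp (-(400 * √(Real.log d)) - Real.log d) := by
    rw [Real.exp_sub, Real.exp_log h.pos]
  rw [h1, Real.rpow_def_of_pos h.pos, ← Real.exp_add, Real.exp_le_exp]
  have hL := h.log_ge
  have h2 : Real.log d * (1 + 1 / (2 * m)) ≤ Real.log d * rhoOptimized m d := by gcongr
  have h3 : 417 * √(Real.log d) ≤ Real.log d * (1 / (2 * m)) := by
    rw [mul_one_div, le_div_iff₀ (by positivity)]
    nth_rewrite 2 [← h.sq_sqrt]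
    nlinarith [h.sqrt_log]
  linarith

/-- The success probability `(1 - δ) ^ K / d` of `IsBalanced.le_treeSuccess` for `δ = 6 / √(ln d)` and
`K = ⌈25 ln d⌉`. -/
theorem exp_le_pow (h : IsLarge d) :
    Real.exp (-(400 * √(Real.log d))) / d ≤
      (1 - 6 / √(Real.log d)) ^ ⌈25 * Real.log d⌉₊ / d := by
  have hx := h.sqrt_log
  have hd := h.pos
  have h6 : 6 / √(Real.log d) ≤ 1 / 2 := by
    rw [div_le_iff₀ (by linarith)]; linarith
  have h0 : 0 < 6 / √(Real.log d) := by positivity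
  have h1 : Real.exp (-(2 * (6 / √(Real.log d)))) ≤ 1 - 6 / √(Real.log d) := by
    rw [← Real.le_log_iff_exp_le (by linarith)]
    refine le_trans ?_ (Real.one_sub_inv_le_log_of_pos (by linarith))
    rw [neg_le_sub_iff_le_add, inv_le_iff_one_le_mul₀ (by linarith)]
    nlinarith
  refine div_le_div_of_nonneg_right ?_ hd.le
  refine le_trans ?_ (pow_le_pow_left₀ (Real.exp_pos _).le h1 _)
  rw [← Real.exp_nat_mul, Real.exp_le_exp]
  have h2 : (⌈25 * Real.log d⌉₊ : ℝ) * (2 * (6 / √(Real.log d))) ≤ 312 * √(Real.log d) := by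
    calc _ ≤ 26 * Real.log d * (2 * (6 / √(Real.log d))) := by gcongr; exact h.ceil_le
      _ = _ := by nth_rewrite 1 [← h.sq_sqrt]; field_simp; norm_num
  linarith

theorem rpow_neg_epsBar_mul (h : IsLarge d) :
    (d : ℝ) ^ (-epsBar m d) * (d : ℝ) ^ (-rhoUniform d) = (d : ℝ) ^ (-rhoOptimized m d) := by
  rw [← Real.rpow_add h.pos, epsBar]
  congr 1
  ring

theorem factor_mul_numPoints_le (h : IsLarge d) (hm : 1 < m) (hmd : 834 * m ≤ √(Real.log d)) :
    factor m d * (numPoints d : ℝ) ^ (-rhoUniform d) ≤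
      Real.exp (-(400 * √(Real.log d))) / d := by
  refine le_trans ?_ (h.rpow_neg_rhoOptimized_le hm hmd)
  have hd1 : (1 : ℝ) ≤ d := by linarith [h.cast_ge]
  have h1 : (numPoints d : ℝ) ^ (-rhoUniform d) ≤ (d : ℝ) ^ (-rhoUniform d) := by
    refine Real.rpow_le_rpow_of_nonpos h.pos ?_ (neg_nonpos.2 h.rhoUniform_nonneg)
    rw [numPoints]
    push_cast
    exact le_self_pow₀ hd1 (by norm_num)
  calc _ ≤ (d : ℝ) ^ (-epsBar m d) * Real.exp (16 * √(Real.log d)) *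
        (d : ℝ) ^ (-rhoUniform d) := by gcongr; exact h.factor_le
    _ = (d : ℝ) ^ (-rhoOptimized m d) * Real.exp (16 * √(Real.log d)) := by
        rw [← h.rpow_neg_epsBar_mul]; ring
    _ ≤ _ := by
        gcongr
        norm_num

/-- The success probability of uniform LSH with at least `⌊k_u + k(d)⌋` hash functions; the floor
costs a factor of at most `2`, and the bound keeps only the hash functions for `d` points. -/
theorem one_sub_pow_le (h : IsLarge d) {k : ℕ} (hk : ⌊kU d + uniformHashes d d⌋₊ ≤ k) :
    (1 - (radius d : ℝ) / d) ^ k ≤ (d : ℝ) ^ (-rhoUniform d) * 2 := by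
  have hr := h.radius_div_le
  have hr0 : 0 ≤ (radius d : ℝ) / d := by positivity
  have hpos : 0 < 1 - (radius d : ℝ) / d := by linarith
  have hle : uniformHashes d d + -1 ≤ k := by
    have h1 := (Nat.lt_floor_add_one (kU d + uniformHashes d d)).le
    have h2 : (⌊kU d + uniformHashes d d⌋₊ : ℝ) ≤ k := by exact_mod_cast hk
    linarith [h.le_kU, h.log_ge]
  calc (1 - (radius d : ℝ) / d) ^ k = (1 - (radius d : ℝ) / d) ^ (k : ℝ) :=
        (Real.rpow_natCast _ _).symm
    _ ≤ (1 - (radius d : ℝ) / d) ^ (uniformHashes d d + -1) :=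
        Real.rpow_le_rpow_of_exponent_ge hpos (by linarith) hle
    _ = (d : ℝ) ^ (-rhoUniform d) * (1 - (radius d : ℝ) / d)⁻¹ := by
        rw [Real.rpow_add hpos, Real.rpow_neg_one]
        congr 1
        rw [Real.rpow_def_of_pos hpos, Real.rpow_def_of_pos h.pos, uniformHashes, rhoUniform,
          one_div, Real.log_inv]
        congr 1
        rw [div_neg]
        ring
    _ ≤ _ := by
        gcongr
        rw [inv_le_comm₀ hpos (by norm_num)]
        linarith

theorem factor_mul_pow_le (h : IsLarge d) (hm : 1 < m) (hmd : 834 * m ≤ √(Real.log d)) {k : ℕ}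
    (hk : ⌊kU d + uniformHashes d d⌋₊ ≤ k) :
    factor m d * (1 - (radius d : ℝ) / d) ^ k ≤ Real.exp (-(400 * √(Real.log d))) / d := by
  refine le_trans ?_ (h.rpow_neg_rhoOptimized_le hm hmd)
  have h2 : 2 ≤ Real.exp √(Real.log d) := by
    linarith [Real.add_one_le_exp √(Real.log d), h.sqrt_log]
  have hr := h.radius_div_le
  have hd := h.pos
  calc factor m d * (1 - (radius d : ℝ) / d) ^ k
      ≤ (d : ℝ) ^ (-epsBar m d) * Real.exp (16 * √(Real.log d)) *
        ((d : ℝ) ^ (-rhoUniform d) * Real.exp √(Real.log d)) := by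
        refine mul_le_mul h.factor_le ((h.one_sub_pow_le hk).trans (by gcongr))
          (pow_nonneg (by linarith) _) (by positivity)
    _ = _ := by
        rw [← h.rpow_neg_epsBar_mul, show 17 * √(Real.log d) =
          16 * √(Real.log d) + √(Real.log d) by ring, Real.exp_add]
        ring

theorem le_dataLaw_isTypical (h : IsLarge d) {S₁ : Finset (Fin d)} (hS : 2 * S₁.card = d) :
    ENNReal.ofReal 0.99 ≤ dataLaw eps₁ eps₂ S₁ (radius d + 1) (numBackground d) (numPlanted d)
      {ω | IsTypical S₁ ⌈25 * Real.log d⌉₊ (1 / (2 * √(Real.log d))) ω} := by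
  have hx := h.sqrt_log
  have h4 := h.four_mul_radius_le
  have htS : radius d + 1 ≤ S₁.card := by omega
  have hpl := isProbabilityMeasure_plantedLaw htS
  have : IsProbabilityMeasure (dataLaw eps₁ eps₂ S₁ (radius d + 1) (numBackground d)
      (numPlanted d)) := by unfold dataLaw; infer_instance
  set A := {ω : (Fin (numBackground d) → Cube d) × (Fin (numPlanted d) → Cube d) |
    IsTypical S₁ ⌈25 * Real.log d⌉₊ (1 / (2 * √(Real.log d))) ω} with hA
  have hbad := dataLaw_not_isTypical_le (N := numBackground d) (s := numPlanted d)
    (K := ⌈25 * Real.log d⌉₊) h.nat_pos (Nat.succ_pos (radius d)) htS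
    (h := 1 / (2 * √(Real.log d))) (by positivity) (by
      rw [div_le_one (by linarith)]; linarith)
  have hN : ((numBackground d : ℝ) + (1 + numPlanted d)) = numPoints d := by
    exact_mod_cast h.numBackground_add
  rw [hN] at hbad
  have hbad' : dataLaw eps₁ eps₂ S₁ (radius d + 1) (numBackground d) (numPlanted d) Aᶜ ≤
      ENNReal.ofReal (1 / 100) := by
    refine hbad.trans (ENNReal.ofReal_le_ofReal ?_)
    linarith [h.collision_background_le, h.collision_planted_le hS, h.unbalanced_le]
  have hcompl := prob_compl_eq_one_sub (μ := dataLaw eps₁ eps₂ S₁ (radius d + 1)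
    (numBackground d) (numPlanted d)) (Set.toFinite Aᶜ).measurableSet
  rw [compl_compl] at hcompl
  rw [hcompl]
  calc ENNReal.ofReal 0.99 = 1 - ENNReal.ofReal (1 / 100) := by
        rw [← ENNReal.ofReal_one, ← ENNReal.ofReal_sub _ (by norm_num)]; norm_num
    _ ≤ _ := tsub_le_tsub_left hbad' 1

end IsLarge

/-- The success probability of every near-optimized tree over typical data. -/
theorem IsTypical.le_treeSuccess {d m : ℕ} {ρ ε : ℝ} (h : IsLarge d) (hm : 0 < m) (h0 : 0 ≤ ρ)
    (h1 : ρ < 1) {S₁ : Finset (Fin d)} (hS : 2 * S₁.card = d)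
    {ω : (Fin (numBackground d) → Cube d) × (Fin (numPlanted d) → Cube d)}
    (hω : IsTypical S₁ ⌈25 * Real.log d⌉₊ (1 / (2 * √(Real.log d))) ω) (hε : 0 ≤ ε)
    (hε₀ : ε ≤ 1 / (√(Real.log d) * numPoints d)) {σ : HashRule d}
    (hσ : IsOptimizedRule (radius d) 1 ρ ε σ) :
    ENNReal.ofReal (Real.exp (-(400 * √(Real.log d))) / d) ≤
      minSuccess (dataset ω) (radius d) (treeSuccess σ 1 m (radius d + 1) (dataset ω)) := by
  have hx := h.sqrt_log
  have hcard : (dataset ω).card = numPoints d := hω.card_dataset.trans h.numBackground_add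
  have hn : (0 : ℝ) < numPoints d := by
    rw [numPoints]; push_cast; exact pow_pos h.pos 6
  have hbal := hω.isBalanced (by positivity) (by
    rw [div_le_div_iff₀ (by linarith) (by norm_num)]; linarith) h.numPlanted_add_one_le
  refine (ENNReal.ofReal_le_ofReal h.exp_le_pow).trans ?_
  have hK : 6 * ⌈25 * Real.log d⌉₊ ≤ d := by
    have : 6 * (⌈25 * Real.log d⌉₊ : ℝ) ≤ d := by
      linarith [h.ceil_le, h.log_le, h.log_ge]
    exact_mod_cast this
  refine hbal.le_treeSuccess h.nat_pos hS hK (by have := h.four_mul_radius_le; omega)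
    (Nat.le_succ _) hm h0 h1 (by positivity) hε ?_ ?_ hσ (by rw [hcard]; exact h.numPoints_le)
  · have h3 : 3 * (radius d : ℝ) / d ≤ 3 * (1 / √(Real.log d)) := by
      rw [mul_div_assoc]; exact mul_le_mul_of_nonneg_left h.radius_le (by norm_num)
    have h4 : ε * (dataset ω).card ≤ 1 / √(Real.log d) := by
      rw [hcard]
      refine (mul_le_mul_of_nonneg_right hε₀ hn.le).trans_eq ?_
      field_simp
    have h5 : 2 * (2 * (1 / (2 * √(Real.log d)))) = 2 * (1 / √(Real.log d)) := by field_simp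
    have h6 : 6 / √(Real.log d) = 6 * (1 / √(Real.log d)) := by ring
    rw [h5, h6]
    linarith
  · rw [div_le_one (by linarith)]; linarith

end LSH

theorem mainTheorem3 :
    ∃ a b : ℝ, 0 < a ∧ 0 < b ∧
      ∀ (m : ℕ) (ρ : ℝ), 1 < m → 1 / 10 < ρ → ρ < 1 →
        ∀ᶠ d : ℕ in atTop,
          a * ((d : ℝ) ^ (-LSH.epsBar m d) * Real.exp (b * √(Real.log d))) ≤ LSH.factor m d ∧
          ∃ ε₀ : ℝ, 0 < ε₀ ∧
            ∀ S₁ : Finset (Fin d), 2 * S₁.card = d →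
              ENNReal.ofReal 0.99 ≤
                LSH.dataLaw LSH.eps₁ LSH.eps₂ S₁ (LSH.radius d + 1)
                    (LSH.numBackground d) (LSH.numPlanted d)
                  {ω | (LSH.dataset ω).card = LSH.numPoints d ∧
                    ∀ (ε : ℝ) (σ : LSH.HashRule d), 0 ≤ ε → ε ≤ ε₀ →
                    LSH.IsOptimizedRule (LSH.radius d) 1 ρ ε σ →
                      ENNReal.ofReal
                          (LSH.factor m d * (LSH.numPoints d : ℝ) ^ (-LSH.rhoUniform d)) ≤
                        LSH.minSuccess (LSH.dataset ω) (LSH.radius d)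
                          (LSH.treeSuccess σ 1 m (LSH.radius d + 1) (LSH.dataset ω)) ∧
                      ∀ k : ℕ, ⌊LSH.kU d + LSH.uniformHashes d d⌋₊ ≤ k →
                        ENNReal.ofReal (LSH.factor m d) *
                            LSH.minSuccess (LSH.dataset ω) (LSH.radius d)
                              (LSH.uniformSuccess k) ≤
                          LSH.minSuccess (LSH.dataset ω) (LSH.radius d)
                            (LSH.treeSuccess σ 1 m (LSH.radius d + 1) (LSH.dataset ω))} := by
  refine ⟨1, 1, one_pos, one_pos, fun m ρ hm hρ0 hρ1 => ?_⟩
  have hmd : ∀ᶠ d : ℕ in atTop, 834 * (m : ℝ) ≤ √(Real.log d) :=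
    (Real.tendsto_sqrt_atTop.comp
      (Real.tendsto_log_atTop.comp tendsto_natCast_atTop_atTop)).eventually_ge_atTop _
  filter_upwards [LSH.eventually_isLarge, hmd] with d h hmd
  have hx := h.sqrt_log
  have hn : (0 : ℝ) < LSH.numPoints d := by
    rw [LSH.numPoints]; push_cast; exact pow_pos h.pos 6
  refine ⟨by rw [one_mul, one_mul]; exact h.le_factor,
    1 / (√(Real.log d) * LSH.numPoints d), by positivity, fun S₁ hS => ?_⟩
  refine (h.le_dataLaw_isTypical hS).trans (measure_mono fun ω hω =>
    ⟨LSH.IsTypical.card_dataset hω |>.trans h.numBackground_add, fun ε σ hε hε₀ hσ => ?_⟩)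
  have htree := LSH.IsTypical.le_treeSuccess (m := m) h (by omega) (by linarith) hρ1 hS hω hε hε₀ hσ
  refine ⟨(ENNReal.ofReal_le_ofReal (h.factor_mul_numPoints_le hm hmd)).trans htree,
    fun k hk => le_trans ?_ htree⟩
  have hU := LSH.minSuccess_uniformSuccess_le (k := k) (r := LSH.radius d) (P := LSH.dataset ω)
    (Finset.mem_insert_self _ _) h.nat_pos
    (by have := h.four_mul_radius_le; omega)
  calc _ ≤ ENNReal.ofReal (LSH.factor m d) *
        ENNReal.ofReal ((1 - (LSH.radius d : ℝ) / d) ^ k) := by gcongr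
    _ = ENNReal.ofReal (LSH.factor m d * (1 - (LSH.radius d : ℝ) / d) ^ k) :=
        (ENNReal.ofReal_mul h.factor_nonneg).symm
    _ ≤ _ := ENNReal.ofReal_le_ofReal (h.factor_mul_pow_le hm hmd hk)
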